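/- Let $N\ge 1$ and let $f:\mathbb{R}^N\times\mathbb{R}\times\mathbb{R}^N\to[0,+\infty]$. For $x\in\mathbb{R}^N$ and $m\in\mathbb{R}$ define the minimal cost \[ H_f(x,m)=\inf\Big\{\int_{\mathbb{R}^N} f(x,u(y),\nabla u(y))\,dy \;:\; u\in W^{1,1}_{\mathrm{loc}}\cap L^1(\mathbb{R}^N),\ \int_{\mathbb{R}^N}u=m\Big\}\in[0,+\infty]. \] Fix a sign $\pm$ and let \[ f'_-(x_0,0^\pm,0)=\liminf_{(x,u,\xi)\to(x_0,0^\pm,0)}\frac{f(x,u,\xi)}{|u|}\in[0,+\infty]. \] Assume: (H1) $f$ is lower semicontinuous on $\mathbb{R}^N\times\mathbb{R}\times\mathbb{R}^N$; (H5) there exist $\alpha,\beta\in(0,+\infty)$ and $p\in(1,+\infty)$ such that $f(x,u,\xi)\ge\alpha|\xi|^p-\beta|u|$ for all $(x,u,\xi)\in\mathbb{R}^N\times\mathbb{R}\times\mathbb{R}^N$; (H6) for every $x_0\in\mathbb{R}^N$, \[ f'_-(x_0,0^\pm,0)\ \ge\ \limsup_{u\to0^\pm}\ \sup_{|\xi|=1}\frac{f(x_0,u,\rho(|u|)\xi)}{|u|},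 \] where $\rho\equiv0$ if $N=1$, and, if $N\ge2$, for some continuous $\rho:(0,1]\to(0,+\infty)$ (possibly depending on $x_0$) satisfying \[ \int_0^1\Big(\int_y^1\frac{dt}{\rho(t)}\Big)^N dy<+\infty . \] Fix $x\in\mathbb{R}^N$. If either $N\ge2$, or $N=1$ and $H_f(x,\cdot)$ is not identically $+\infty$ on $\{m\in\mathbb{R}:\pm m>0\}$, then the limit $H_f'(x,0^\pm):=\lim_{m\to0^\pm}\frac{H_f(x,m)}{|m|}$ exists in $[0,+\infty]$ and \[ H_f'(x,0^\pm)=f'_-(x,0^\pm,0). \] -/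

import Mathlib

open MeasureTheory Filter Topology Set
open scoped ENNReal ContDiff

namespace MinimalCost

/-- `G` is a weak gradient of `u` on `ℝ^N`, both being locally integrable.
A function `u` lies in `W^{1,1}_loc(ℝ^N)` exactly when it has such a weak gradient. -/
structure HasWeakGradient {N : ℕ} (u : EuclideanSpace ℝ (Fin N) → ℝ)
    (G : EuclideanSpace ℝ (Fin N) → EuclideanSpace ℝ (Fin N)) : Prop where
  locallyIntegrable : LocallyIntegrable u volume
  locallyIntegrable_grad : LocallyIntegrable G volume
  integral_eq : ∀ φ : EuclideanSpace ℝ (Fin N) → ℝ, ContDiff ℝ ∞ φ → HasCompactSupport φ →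
    ∀ v : EuclideanSpace ℝ (Fin N),
      ∫ y, u y * fderiv ℝ φ y v = -∫ y, φ y * inner ℝ (G y) v

/-- Weak gradients are unique almost everywhere. -/
theorem HasWeakGradient.ae_eq {N : ℕ} {u : EuclideanSpace ℝ (Fin N) → ℝ}
    {G G' : EuclideanSpace ℝ (Fin N) → EuclideanSpace ℝ (Fin N)}
    (h : HasWeakGradient u G) (h' : HasWeakGradient u G') : G =ᵐ[volume] G' := by
  refine ae_eq_of_integral_contDiff_smul_eq h.locallyIntegrable_grad h'.locallyIntegrable_grad ?_
  intro φ hφ hc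
  refine ext_inner_right ℝ fun v => ?_
  have key : ∀ {K : EuclideanSpace ℝ (Fin N) → EuclideanSpace ℝ (Fin N)},
      HasWeakGradient u K →
      inner ℝ (∫ y, φ y • K y) v = -∫ y, u y * fderiv ℝ φ y v := by
    intro K hK
    have hi : Integrable (fun y => φ y • K y) volume :=
      hK.locallyIntegrable_grad.integrable_smul_left_of_hasCompactSupport hφ.continuous hc
    rw [hK.integral_eq φ hφ hc v, neg_neg, real_inner_comm, ← integral_inner hi v]
    refine integral_congr_ae (Eventually.of_forall fun y => ?_)
    simp only [inner_smul_right, real_inner_comm]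
  rw [key h, key h']

/-- The energy `∫ f(x, u(y), ∇u(y)) dy` of `u`, which is `+∞` (an empty infimum) when `u` is not in
`W^{1,1}_loc(ℝ^N)`. The weak gradient being unique almost everywhere, the infimum bears on a single
value; see `energy_eq`. -/
noncomputable def energy {N : ℕ}
    (f : EuclideanSpace ℝ (Fin N) → ℝ → EuclideanSpace ℝ (Fin N) → ℝ≥0∞)
    (x : EuclideanSpace ℝ (Fin N)) (u : EuclideanSpace ℝ (Fin N) → ℝ) : ℝ≥0∞ :=
  ⨅ (G : EuclideanSpace ℝ (Fin N) → EuclideanSpace ℝ (Fin N)) (_ : HasWeakGradient u G),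
    ∫⁻ y, f x (u y) (G y)

/-- The energy of `u` is computed with any weak gradient of `u`. -/
theorem energy_eq {N : ℕ}
    (f : EuclideanSpace ℝ (Fin N) → ℝ → EuclideanSpace ℝ (Fin N) → ℝ≥0∞)
    (x : EuclideanSpace ℝ (Fin N)) {u : EuclideanSpace ℝ (Fin N) → ℝ}
    {G : EuclideanSpace ℝ (Fin N) → EuclideanSpace ℝ (Fin N)} (h : HasWeakGradient u G) :
    energy f x u = ∫⁻ y, f x (u y) (G y) := by
  refine le_antisymm (iInf₂_le G h) (le_iInf₂ fun G' h' => le_of_eq (lintegral_congr_ae ?_))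
  filter_upwards [h.ae_eq h'] with y hy
  rw [hy]

/-- The minimal cost `H_f(x, m)`: the infimum of the energy at `x` under the mass constraint
`∫ u = m`, over (signed) functions in `W^{1,1}_loc ∩ L^1(ℝ^N)`. -/
noncomputable def minimalCost {N : ℕ}
    (f : EuclideanSpace ℝ (Fin N) → ℝ → EuclideanSpace ℝ (Fin N) → ℝ≥0∞)
    (x : EuclideanSpace ℝ (Fin N)) (m : ℝ) : ℝ≥0∞ :=
  ⨅ (u : EuclideanSpace ℝ (Fin N) → ℝ) (_ : Integrable u volume ∧ ∫ y, u y = m), energy f x u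

/-- The lower slope `f'_-(x₀, 0^±, 0)`: the lower limit of `f(x, u, ξ) / |u|` as
`(x, u, ξ) → (x₀, 0, 0)` with `u ∈ s`. It is `f'_-(x₀, 0^+, 0)` for `s = (0, ∞)` and
`f'_-(x₀, 0^-, 0)` for `s = (-∞, 0)`. -/
noncomputable def lowerSlope {N : ℕ} (s : Set ℝ)
    (f : EuclideanSpace ℝ (Fin N) → ℝ → EuclideanSpace ℝ (Fin N) → ℝ≥0∞)
    (x₀ : EuclideanSpace ℝ (Fin N)) : ℝ≥0∞ :=
  liminf (fun z : EuclideanSpace ℝ (Fin N) × ℝ × EuclideanSpace ℝ (Fin N) =>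
      f z.1 z.2.1 z.2.2 / ENNReal.ofReal |z.2.1|)
    (𝓝 x₀ ×ˢ 𝓝[s] (0 : ℝ) ×ˢ 𝓝 (0 : EuclideanSpace ℝ (Fin N)))

/-- The upper slope along `ρ`: the upper limit, as `u → 0` with `u ∈ s`, of
`sup_{|ξ| = 1} f(x₀, u, ρ(|u|) ξ) / |u|`. -/
noncomputable def upperSlope {N : ℕ} (s : Set ℝ)
    (f : EuclideanSpace ℝ (Fin N) → ℝ → EuclideanSpace ℝ (Fin N) → ℝ≥0∞)
    (ρ : ℝ → ℝ) (x₀ : EuclideanSpace ℝ (Fin N)) : ℝ≥0∞ :=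
  limsup (fun u : ℝ =>
      ⨆ (ξ : EuclideanSpace ℝ (Fin N)) (_ : ‖ξ‖ = 1),
        f x₀ u (ρ |u| • ξ) / ENNReal.ofReal |u|)
    (𝓝[s] (0 : ℝ))

/-- `ρ` is a continuous positive function on `(0, 1]` with
`∫_0^1 (∫_y^1 dt / ρ(t))^N dy < ∞`. Values outside `(0, 1]` are irrelevant. -/
structure IsAdmissibleProfile (N : ℕ) (ρ : ℝ → ℝ) : Prop where
  continuousOn : ContinuousOn ρ (Ioc 0 1)
  pos : ∀ t ∈ Ioc (0 : ℝ) 1, 0 < ρ t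
  lintegral_lt_top :
    ∫⁻ y in Ioc (0 : ℝ) 1, (∫⁻ t in Ioc y 1, ENNReal.ofReal (1 / ρ t)) ^ N < ⊤

/-- Lower semicontinuity of the Lagrangian in all its variables jointly. -/
def HypLsc {N : ℕ}
    (f : EuclideanSpace ℝ (Fin N) → ℝ → EuclideanSpace ℝ (Fin N) → ℝ≥0∞) : Prop :=
  LowerSemicontinuous (fun z : EuclideanSpace ℝ (Fin N) × ℝ × EuclideanSpace ℝ (Fin N) =>
    f z.1 z.2.1 z.2.2)

/-- Compactness: `f(x, u, ξ) ≥ α |ξ|^p - β |u|` for some `α, β ∈ (0, ∞)` and `p ∈ (1, ∞)`. As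
`f ≥ 0`, replacing the right-hand side by its positive part changes nothing. -/
def HypCompact {N : ℕ}
    (f : EuclideanSpace ℝ (Fin N) → ℝ → EuclideanSpace ℝ (Fin N) → ℝ≥0∞) : Prop :=
  ∃ α β p : ℝ, 0 < α ∧ 0 < β ∧ 1 < p ∧
    ∀ (x : EuclideanSpace ℝ (Fin N)) (u : ℝ) (ξ : EuclideanSpace ℝ (Fin N)),
      ENNReal.ofReal (α * ‖ξ‖ ^ p - β * |u|) ≤ f x u ξ

/-- The slope condition on the side `s` of the origin: at every `x₀`, the lower slope of `f`
dominates its upper slope along some `ρ`, where `ρ = 0` in dimension one and `ρ` is an admissible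
profile in dimension at least two. -/
def HypSlope {N : ℕ} (s : Set ℝ)
    (f : EuclideanSpace ℝ (Fin N) → ℝ → EuclideanSpace ℝ (Fin N) → ℝ≥0∞) : Prop :=
  ∀ x₀ : EuclideanSpace ℝ (Fin N), ∃ ρ : ℝ → ℝ,
    (N = 1 → ρ = 0) ∧ (2 ≤ N → IsAdmissibleProfile N ρ) ∧
      upperSlope s f ρ x₀ ≤ lowerSlope s f x₀

end MinimalCost

/-! The reflection `f(x, -u, -ξ)` exchanges the two signs, so only `0⁺` matters. The lower limit of
`H_f(x, m) / m` is bounded below by coercivity and the Sobolev inequality; its upper limit is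
bounded above by explicit competitors.

Lower bound (`eventually_le_lintegral`). Let `c' > 0` lie below the lower slope. Coercivity removes
the smallness condition on `ξ`: there is `d > 0` with `f(x, t, ξ) ≥ c' t` for all `ξ` and `0 < t <
d`. Hence the part of a competitor with values in `(0, d)` costs at least `c'` per unit of mass, and
only the mass at heights at least `d` could be cheaper. That mass is negligible. If the energy is
`O(m)`, Chebyshev gives `|{d/4 < u ≤ d/2}| = O(m)`, and coercivity then bounds the integral of
`|∇u|` over this layer by `O(m)`. The Sobolev inequality for the truncation of `u` between the two
levels yields `|{u > d/2}| = O(m)`. A second application, to `(u - d/2)⁺` with the Hölder factor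
`|{u > d/2}|^(1/N)`, gives `∫ (u - d/2)⁺ = O(m^(1/N)) m = o(m)`. The negative part of `u` only
lowers the mass. The arithmetic of this bootstrap is isolated in `lowerBound_real_ineq`.

Upper bound, `N ≥ 2` (`limsup_le_of_two_le_dim`). Let `v` solve `v' = -ρ(v)`, `v(0) = 1`, and take
`u(y) = v(|y| + a)`. Then `∇u = ρ(u) ξ` with `|ξ| = 1` wherever `u > 0`, so the integrand is exactly
of the kind controlled by the upper slope, uniformly once `u` is small. The superlevel sets of
`v(|y|)` are balls whose radius is the hitting time of `v`, and the integral condition on `ρ` says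
by the layer-cake formula that the total mass is finite. Letting `a` grow makes `u` uniformly small
and realises every small mass (`exists_radial_mass`). Where `u = 0` nothing is paid, because a
finite lower slope forces `f(x, 0, 0) = 0`.

Upper bound, `N = 1` (`minimalCost_le_of_dim_one`). Start from one competitor of finite energy and
positive mass and truncate it between `0` and a small `h`. Its mass and its transition energy become
as small as desired. The missing mass is supplied by inserting a long interval on which the function
equals `h`, at a cost per unit of mass close to the slope, since `ρ = 0`. -/

namespace MinimalCost

/-! ### Mollification -/

/-- The Euclidean space `ℝ^N`. -/
abbrev RN (N : ℕ) := EuclideanSpace ℝ (Fin N)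

/-- Scheffé's argument: Fatou's lemma applied to the nonnegative functions `‖h n‖ + ‖k‖ - ‖h n -
k‖`, whose pointwise limit is `2‖k‖`. No dominating function is needed, which suits mollifications,
as they do not increase the `L¹` norm. -/
theorem tendsto_lintegral_enorm_sub_of_ae_tendsto {α F : Type*} [MeasurableSpace α]
    {μ : Measure α} [NormedAddCommGroup F] {h : ℕ → α → F} {k : α → F}
    (hm : ∀ n, AEStronglyMeasurable (h n) μ) (hk : Integrable k μ)
    (hle : ∀ n, ∫⁻ a, ‖h n a‖ₑ ∂μ ≤ ∫⁻ a, ‖k a‖ₑ ∂μ)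
    (hlim : ∀ᵐ a ∂μ, Tendsto (fun n => h n a) atTop (𝓝 (k a))) :
    Tendsto (fun n => ∫⁻ a, ‖h n a - k a‖ₑ ∂μ) atTop (𝓝 0) := by
  set I := ∫⁻ a, ‖k a‖ₑ ∂μ with hI
  have hIfin : I ≠ ⊤ := hk.2.ne
  have hsub : ∀ n, AEMeasurable (fun a => ‖h n a - k a‖ₑ) μ := fun n =>
    ((hm n).sub hk.1).enorm
  have hd : ∀ n, ∫⁻ a, ‖h n a - k a‖ₑ ∂μ ≤ I + I := fun n => by
    calc ∫⁻ a, ‖h n a - k a‖ₑ ∂μ ≤ ∫⁻ a, ‖h n a‖ₑ + ‖k a‖ₑ ∂μ :=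
          lintegral_mono fun a => enorm_sub_le
      _ = ∫⁻ a, ‖h n a‖ₑ ∂μ + I := lintegral_add_right' _ hk.1.enorm
      _ ≤ I + I := by gcongr; exact hle n
  have key : I + I ≤ liminf (fun n => (I + I) - ∫⁻ a, ‖h n a - k a‖ₑ ∂μ) atTop := by
    calc I + I = ∫⁻ a, ‖k a‖ₑ + ‖k a‖ₑ ∂μ := (lintegral_add_right' _ hk.1.enorm).symm
      _ ≤ ∫⁻ a, liminf (fun n => (‖h n a‖ₑ + ‖k a‖ₑ) - ‖h n a - k a‖ₑ) atTop ∂μ := by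
          refine lintegral_mono_ae ?_
          filter_upwards [hlim] with a ha
          have h1 : Tendsto (fun n => (‖h n a‖ₑ + ‖k a‖ₑ) - ‖h n a - k a‖ₑ) atTop
              (𝓝 ((‖k a‖ₑ + ‖k a‖ₑ) - ‖k a - k a‖ₑ)) := by
            refine ENNReal.Tendsto.sub (ha.enorm.add tendsto_const_nhds)
              (ha.sub tendsto_const_nhds).enorm ?_
            exact Or.inr (by simp)
          rw [h1.liminf_eq]; simp
      _ ≤ liminf (fun n => ∫⁻ a, (‖h n a‖ₑ + ‖k a‖ₑ) - ‖h n a - k a‖ₑ ∂μ) atTop :=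
          lintegral_liminf_le' fun n => ((hm n).enorm.add hk.1.enorm).sub (hsub n)
      _ ≤ liminf (fun n => (I + I) - ∫⁻ a, ‖h n a - k a‖ₑ ∂μ) atTop := by
          refine liminf_le_liminf (Eventually.of_forall fun n => ?_)
          rw [lintegral_sub' (hsub n) ((hd n).trans_lt (by finiteness)).ne
            (ae_of_all _ fun a => enorm_sub_le), lintegral_add_right' _ hk.1.enorm]
          gcongr
          exact hle n
  rw [ENNReal.tendsto_nhds_zero]
  intro ε hε
  rcases eq_or_ne I 0 with h0 | h0
  · exact Eventually.of_forall fun n => (hd n).trans (by simp [h0])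
  have hlt : (I + I) - ε < liminf (fun n => (I + I) - ∫⁻ a, ‖h n a - k a‖ₑ ∂μ) atTop :=
    (ENNReal.sub_lt_self (by finiteness) (by simp [h0]) hε.ne').trans_le key
  filter_upwards [eventually_lt_of_lt_liminf hlt] with n hn
  by_contra hc
  exact absurd hn (not_lt.2 (tsub_le_tsub_left (not_le.1 hc).le _))

section Mollify

variable {N : ℕ} {F : Type*} [NormedAddCommGroup F] [NormedSpace ℝ F]

/-- The convolution of `g` with the normalised bump function `φ`. -/
noncomputable def mollify (φ : ContDiffBump (0 : RN N)) (g : RN N → F) : RN N → F :=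
  convolution (φ.normed volume) g (ContinuousLinearMap.lsmul ℝ ℝ) volume

theorem mollify_apply (φ : ContDiffBump (0 : RN N)) (g : RN N → F) (x : RN N) :
    mollify φ g x = ∫ t, φ.normed volume (x - t) • g t := by
  rw [mollify, convolution_eq_swap]; rfl

theorem integrable_mollify (φ : ContDiffBump (0 : RN N)) {g : RN N → F} (hg : Integrable g) :
    Integrable (mollify φ g) :=
  φ.integrable_normed.integrable_convolution _ hg

/-- Tonelli and translation invariance, the kernel being nonnegative with integral one. -/
theorem lintegral_enorm_mollify_le (φ : ContDiffBump (0 : RN N)) {g : RN N → F}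
    (hg : Integrable g) : ∫⁻ x, ‖mollify φ g x‖ₑ ≤ ∫⁻ x, ‖g x‖ₑ := by
  have hm : AEStronglyMeasurable
      (fun p : RN N × RN N => φ.normed volume p.2 • g (p.1 - p.2)) (volume.prod volume) :=
    (φ.integrable_normed (μ := volume)).aestronglyMeasurable.convolution_integrand
      (ContinuousLinearMap.lsmul ℝ ℝ) hg.aestronglyMeasurable
  calc ∫⁻ x, ‖mollify φ g x‖ₑ
      ≤ ∫⁻ x, ∫⁻ t, ‖φ.normed volume t • g (x - t)‖ₑ :=
        lintegral_mono fun x => enorm_integral_le_lintegral_enorm _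
    _ = ∫⁻ t, ∫⁻ x, ‖φ.normed volume t • g (x - t)‖ₑ := lintegral_lintegral_swap hm.enorm
    _ = ∫⁻ t, ‖φ.normed volume t‖ₑ * ∫⁻ x, ‖g x‖ₑ := by
        refine lintegral_congr fun t => ?_
        simp_rw [enorm_smul]
        rw [lintegral_const_mul' _ _ (by simp), lintegral_sub_right_eq_self (fun x => ‖g x‖ₑ)]
    _ = (∫⁻ t, ‖φ.normed volume t‖ₑ) * ∫⁻ x, ‖g x‖ₑ :=
        lintegral_mul_const' _ _ hg.2.ne
    _ = ∫⁻ x, ‖g x‖ₑ := by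
        have : ∫⁻ t, ‖φ.normed (volume : Measure (RN N)) t‖ₑ = 1 := by
          have h1 := ofReal_integral_eq_lintegral_ofReal (φ.integrable_normed (μ := volume))
            (ae_of_all _ fun t => φ.nonneg_normed t)
          rw [φ.integral_normed] at h1
          rw [← ENNReal.ofReal_one, h1]
          exact lintegral_congr fun t => Real.enorm_of_nonneg (φ.nonneg_normed t)
        rw [this, one_mul]

/-- A sequence of bump functions shrinking to the origin. -/
noncomputable def bumpSeq (N n : ℕ) : ContDiffBump (0 : RN N) where
  rIn := 1 / ((n : ℝ) + 1)
  rOut := 2 / ((n : ℝ) + 1)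
  rIn_pos := by positivity
  rIn_lt_rOut := by gcongr; norm_num

theorem ae_tendsto_mollify [CompleteSpace F] {g : RN N → F} (hg : LocallyIntegrable g) :
    ∀ᵐ x, Tendsto (fun n => mollify (bumpSeq N n) g x) atTop (𝓝 (g x)) := by
  refine ContDiffBump.ae_convolution_tendsto_right_of_locallyIntegrable (K := 2) ?_ ?_ hg
  · have := (tendsto_one_div_add_atTop_nhds_zero_nat (𝕜 := ℝ)).const_mul 2
    simpa [bumpSeq, div_eq_mul_inv] using this
  · exact Eventually.of_forall fun n => by simp [bumpSeq, div_eq_mul_inv]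

theorem tendsto_lintegral_mollify_sub [CompleteSpace F] {g : RN N → F} (hg : Integrable g) :
    Tendsto (fun n => ∫⁻ x, ‖mollify (bumpSeq N n) g x - g x‖ₑ) atTop (𝓝 0) :=
  tendsto_lintegral_enorm_sub_of_ae_tendsto
    (fun _ => (integrable_mollify _ hg).aestronglyMeasurable) hg
    (fun _ => lintegral_enorm_mollify_le _ hg) (ae_tendsto_mollify hg.locallyIntegrable)

theorem contDiff_mollify (φ : ContDiffBump (0 : RN N)) {g : RN N → F}
    (hg : LocallyIntegrable g) : ContDiff ℝ ∞ (mollify φ g) :=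
  φ.hasCompactSupport_normed.contDiff_convolution_left _ φ.contDiff_normed hg

theorem hasCompactSupport_mollify (φ : ContDiffBump (0 : RN N)) {g : RN N → F}
    (hg : HasCompactSupport g) : HasCompactSupport (mollify φ g) :=
  φ.hasCompactSupport_normed.convolution _ hg

/-- The derivative of a convolution falls on the kernel, and the translated reflected kernel `t ↦
φ(x - t)` is itself a test function, so the weak formulation moves the derivative onto `G`. -/
theorem HasWeakGradient.fderiv_mollify {u : RN N → ℝ} {G : RN N → RN N}
    (h : HasWeakGradient u G) (φ : ContDiffBump (0 : RN N)) (x v : RN N) :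
    fderiv ℝ (mollify φ u) x v = inner ℝ (mollify φ G x) v := by
  have h1 : HasFDerivAt (mollify φ u) _ x :=
    φ.hasCompactSupport_normed.hasFDerivAt_convolution_left
    (ContinuousLinearMap.lsmul ℝ ℝ) (φ.contDiff_normed (n := 1)) h.locallyIntegrable x
  have hφ : ContDiff ℝ ∞ (fun t => φ.normed volume (x - t)) :=
    φ.contDiff_normed.comp (contDiff_const.sub contDiff_id)
  have hc : HasCompactSupport (fun t => φ.normed volume (x - t)) :=
    φ.hasCompactSupport_normed.comp_homeomorph (Homeomorph.subLeft x)
  have hint : Integrable (fun t => φ.normed volume (x - t) • G t) :=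
    h.locallyIntegrable_grad.integrable_smul_left_of_hasCompactSupport hφ.continuous hc
  have hD : ∀ t, fderiv ℝ (fun t => φ.normed volume (x - t)) t v =
      -fderiv ℝ (φ.normed volume) (x - t) v := fun t => by
    have h2 : HasFDerivAt (fun t => φ.normed volume (x - t)) _ t :=
      (φ.contDiff_normed (n := 1)).differentiable (by simp) (x - t) |>.hasFDerivAt.comp t
        ((hasFDerivAt_const x t).sub (hasFDerivAt_id t))
    rw [h2.fderiv]; simp
  have h3 := h.integral_eq _ hφ hc v
  rw [mollify_apply, real_inner_comm, ← integral_inner hint v, h1.fderiv, convolution_eq_swap,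
    ContinuousLinearMap.integral_apply]
  · have : (fun t => inner ℝ v (φ.normed volume (x - t) • G t)) =
        fun t => φ.normed volume (x - t) * inner ℝ (G t) v := by
      ext t; rw [inner_smul_right, real_inner_comm]
    rw [this, ← neg_eq_iff_eq_neg.2 h3, ← integral_neg]
    refine integral_congr_ae (ae_of_all _ fun t => ?_)
    simp [hD, mul_comm]
  · exact ((φ.hasCompactSupport_normed.fderiv ℝ).convolutionExists_left _
      ((φ.contDiff_normed (n := 1)).continuous_fderiv (by simp)) h.locallyIntegrable
      x).integrable_swap

end Mollify

end MinimalCost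

namespace MinimalCost

/-! ### Calculus of weak gradients -/

section Calculus

variable {N : ℕ} {u : RN N → ℝ} {G : RN N → RN N}

theorem _root_.MeasureTheory.LocallyIntegrable.norm_real {X F : Type*} [TopologicalSpace X]
    [SecondCountableTopology X] [MeasurableSpace X] {μ : Measure X} [NormedAddCommGroup F]
    {g : X → F} (hg : LocallyIntegrable g μ) : LocallyIntegrable (fun y => ‖g y‖) μ :=
  hg.mono hg.aestronglyMeasurable.norm (ae_of_all _ fun y => by simp)

theorem HasWeakGradient.sub {u' : RN N → ℝ} {G' : RN N → RN N} (h : HasWeakGradient u G)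
    (h' : HasWeakGradient u' G') :
    HasWeakGradient (fun y => u y - u' y) (fun y => G y - G' y) := by
  refine ⟨h.locallyIntegrable.sub h'.locallyIntegrable,
    h.locallyIntegrable_grad.sub h'.locallyIntegrable_grad, fun φ hφ hc v => ?_⟩
  have hd : Continuous fun y => fderiv ℝ φ y v :=
    (hφ.continuous_fderiv (by simp)).clm_apply continuous_const
  have hdc : HasCompactSupport fun y => fderiv ℝ φ y v := hc.fderiv_apply ℝ v
  have i1 : ∀ {w : RN N → ℝ}, LocallyIntegrable w volume →
      Integrable fun y => w y * fderiv ℝ φ y v := fun hw =>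
    hw.integrable_smul_right_of_hasCompactSupport hd hdc
  have i2 : ∀ {K : RN N → RN N}, LocallyIntegrable K volume →
      Integrable fun y => φ y * inner ℝ (K y) v := fun hK => by
    have := (hK.integrable_smul_left_of_hasCompactSupport hφ.continuous hc).inner_const (𝕜 := ℝ) v
    simpa [real_inner_smul_left] using this
  simp only [sub_mul, inner_sub_left, mul_sub]
  rw [integral_sub (i1 h.locallyIntegrable) (i1 h'.locallyIntegrable),
    integral_sub (i2 h.locallyIntegrable_grad) (i2 h'.locallyIntegrable_grad),
    h.integral_eq φ hφ hc v, h'.integral_eq φ hφ hc v]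
  ring

theorem HasWeakGradient.congr_ae {u' : RN N → ℝ} {G' : RN N → RN N} (h : HasWeakGradient u G)
    (hu : u =ᵐ[volume] u') (hG : G =ᵐ[volume] G') : HasWeakGradient u' G' := by
  refine ⟨h.locallyIntegrable.congr hu, h.locallyIntegrable_grad.congr hG, fun φ hφ hc v => ?_⟩
  have := h.integral_eq φ hφ hc v
  rw [integral_congr_ae (g := fun y => u y * fderiv ℝ φ y v), this,
    integral_congr_ae (g := fun y => φ y * inner ℝ (G' y) v)]
  · filter_upwards [hG] with y hy; rw [hy]
  · filter_upwards [hu] with y hy; rw [hy]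

theorem HasWeakGradient.neg (h : HasWeakGradient u G) :
    HasWeakGradient (fun y => -u y) (fun y => -G y) := by
  refine ⟨h.locallyIntegrable.neg, h.locallyIntegrable_grad.neg, fun φ hφ hc v => ?_⟩
  have := h.integral_eq φ hφ hc v
  simp only [neg_mul, inner_neg_left, mul_neg, integral_neg, this]

/-- Dominated limits of weakly differentiable functions. -/
theorem HasWeakGradient.of_tendsto {w : ℕ → RN N → ℝ} {K : ℕ → RN N → RN N} {b B : RN N → ℝ}
    (h : ∀ n, HasWeakGradient (w n) (K n)) (hb : LocallyIntegrable b) (hB : LocallyIntegrable B)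
    (hwb : ∀ n, ∀ᵐ y, ‖w n y‖ ≤ b y) (hKB : ∀ n, ∀ᵐ y, ‖K n y‖ ≤ B y)
    (hw : ∀ᵐ y, Tendsto (fun n => w n y) atTop (𝓝 (u y)))
    (hK : ∀ᵐ y, Tendsto (fun n => K n y) atTop (𝓝 (G y))) : HasWeakGradient u G := by
  have hub : ∀ᵐ y, ‖u y‖ ≤ ‖b y‖ := by
    filter_upwards [ae_all_iff.2 hwb, hw] with y h1 h2
    exact le_of_tendsto h2.norm (Eventually.of_forall fun n => (h1 n).trans (le_abs_self _))
  have hGB : ∀ᵐ y, ‖G y‖ ≤ ‖B y‖ := by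
    filter_upwards [ae_all_iff.2 hKB, hK] with y h1 h2
    exact le_of_tendsto h2.norm (Eventually.of_forall fun n => (h1 n).trans (le_abs_self _))
  refine ⟨hb.mono (aestronglyMeasurable_of_tendsto_ae atTop
      (fun n => (h n).locallyIntegrable.aestronglyMeasurable) hw) hub,
    hB.mono (aestronglyMeasurable_of_tendsto_ae atTop
      (fun n => (h n).locallyIntegrable_grad.aestronglyMeasurable) hK) hGB, fun φ hφ hc v => ?_⟩
  have hd : Continuous fun y => fderiv ℝ φ y v :=
    (hφ.continuous_fderiv (by simp)).clm_apply continuous_const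
  have hdc : HasCompactSupport fun y => fderiv ℝ φ y v := hc.fderiv_apply ℝ v
  have t1 : Tendsto (fun n => ∫ y, w n y * fderiv ℝ φ y v) atTop
      (𝓝 (∫ y, u y * fderiv ℝ φ y v)) := by
    refine tendsto_integral_of_dominated_convergence (fun y => ‖b y * fderiv ℝ φ y v‖)
      (fun n => (h n).locallyIntegrable.aestronglyMeasurable.mul hd.aestronglyMeasurable)
      (hb.integrable_smul_right_of_hasCompactSupport hd hdc).norm (fun n => ?_) ?_
    · filter_upwards [hwb n] with y hy
      rw [norm_mul, norm_mul]; gcongr; exact hy.trans (le_abs_self _)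
    · filter_upwards [hw] with y hy using hy.mul_const _
  have t2 : Tendsto (fun n => ∫ y, φ y * inner ℝ (K n y) v) atTop
      (𝓝 (∫ y, φ y * inner ℝ (G y) v)) := by
    refine tendsto_integral_of_dominated_convergence (fun y => ‖φ y * B y‖ * ‖v‖)
      (fun n => hφ.continuous.aestronglyMeasurable.mul
        ((h n).locallyIntegrable_grad.aestronglyMeasurable.inner aestronglyMeasurable_const))
      ((hB.integrable_smul_left_of_hasCompactSupport hφ.continuous hc).norm.mul_const _)
      (fun n => ?_) ?_
    · filter_upwards [hKB n] with y hy
      rw [norm_mul, norm_mul, mul_assoc]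
      gcongr
      refine (norm_inner_le_norm _ _).trans ?_
      gcongr; exact hy.trans (le_abs_self _)
    · filter_upwards [hK] with y hy using (hy.inner tendsto_const_nhds).const_mul _
  refine tendsto_nhds_unique t1 ?_
  simp only [(h _).integral_eq φ hφ hc v]
  exact t2.neg

/-- The product of a weakly differentiable function and of a smooth cutoff. -/
theorem HasWeakGradient.smul_cutoff (h : HasWeakGradient u G) {χ : RN N → ℝ}
    (hχ : ContDiff ℝ ∞ χ) (hcχ : HasCompactSupport χ) :
    HasWeakGradient (fun y => χ y * u y) (fun y => χ y • G y + u y • gradient χ y) := by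
  have hg : Continuous (gradient χ) :=
    (InnerProductSpace.toDual ℝ (RN N)).symm.continuous.comp (hχ.continuous_fderiv (by simp))
  have hgc : HasCompactSupport (gradient χ) :=
    (hcχ.fderiv ℝ).comp_left (map_zero (InnerProductSpace.toDual ℝ (RN N)).symm)
  have i0 := h.locallyIntegrable.integrable_smul_left_of_hasCompactSupport hχ.continuous hcχ
  have i1 := h.locallyIntegrable_grad.integrable_smul_left_of_hasCompactSupport hχ.continuous hcχ
  have i2 := h.locallyIntegrable.integrable_smul_right_of_hasCompactSupport hg hgc
  refine ⟨i0.locallyIntegrable, (i1.add i2).locallyIntegrable, fun φ hφ hc v => ?_⟩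
  have h1 := h.integral_eq (fun y => χ y * φ y) (hχ.mul hφ) (hc.mul_left) v
  have hD : ∀ y, fderiv ℝ (fun y => χ y * φ y) y v =
      χ y * fderiv ℝ φ y v + φ y * inner ℝ (gradient χ y) v := fun y => by
    rw [fderiv_fun_mul (hχ.differentiable (by simp) y) (hφ.differentiable (by simp) y),
      inner_gradient_left]
    simp
  have hd : Continuous fun y => fderiv ℝ φ y v :=
    (hφ.continuous_fderiv (by simp)).clm_apply continuous_const
  have hdc : HasCompactSupport fun y => fderiv ℝ φ y v := hc.fderiv_apply ℝ v
  have j1 : Integrable fun y => χ y * u y * fderiv ℝ φ y v :=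
    i0.locallyIntegrable.integrable_smul_right_of_hasCompactSupport hd hdc
  have j2 : Integrable fun y => φ y * inner ℝ (u y • gradient χ y) v := by
    have := (i2.locallyIntegrable.integrable_smul_left_of_hasCompactSupport
      hφ.continuous hc).inner_const (𝕜 := ℝ) v
    simpa [real_inner_smul_left] using this
  have j3 : Integrable fun y => φ y * inner ℝ (χ y • G y) v := by
    have := (i1.locallyIntegrable.integrable_smul_left_of_hasCompactSupport
      hφ.continuous hc).inner_const (𝕜 := ℝ) v
    simpa [real_inner_smul_left] using this
  have e1 : ∫ y, u y * fderiv ℝ (fun y => χ y * φ y) y v =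
      (∫ y, χ y * u y * fderiv ℝ φ y v) + ∫ y, φ y * inner ℝ (u y • gradient χ y) v := by
    rw [← integral_add j1 j2]
    refine integral_congr_ae (ae_of_all _ fun y => ?_)
    simp only [hD, real_inner_smul_left]; ring
  have e2 : ∫ y, χ y * φ y * inner ℝ (G y) v = ∫ y, φ y * inner ℝ (χ y • G y) v := by
    refine integral_congr_ae (ae_of_all _ fun y => ?_)
    simp only [real_inner_smul_left]; ring
  simp only [inner_add_left, mul_add]
  rw [integral_add j3 j2]
  rw [e1, e2] at h1
  linarith

/-- Dilations of a single bump function. The decay of their gradients is what makes cutting off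
harmless in the Sobolev inequality for functions that are merely integrable. -/
theorem exists_cutoff (N : ℕ) : ∃ (C : ℝ) (χ : ℕ → RN N → ℝ), ∀ n, ContDiff ℝ ∞ (χ n) ∧
    HasCompactSupport (χ n) ∧ (∀ y, |χ n y| ≤ 1) ∧
    (∀ y ∈ Metric.closedBall (0 : RN N) (n + 1), χ n y = 1) ∧
    ∀ y, ‖gradient (χ n) y‖ ≤ C / (n + 1) := by
  let b : ContDiffBump (0 : RN N) := ⟨1, 2, one_pos, one_lt_two⟩
  have hb : ContDiff ℝ ∞ b := b.contDiff
  obtain ⟨C, hC⟩ := (hb.continuous_fderiv (by simp)).bounded_above_of_compact_support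
    (b.hasCompactSupport.fderiv ℝ)
  refine ⟨C, fun n y => b (((n : ℝ) + 1)⁻¹ • y), fun n => ?_⟩
  have hn : (0 : ℝ) < (n : ℝ) + 1 := by positivity
  refine ⟨hb.comp (contDiff_const_smul _), ?_, fun y => ?_, fun y hy => ?_, fun y => ?_⟩
  · exact b.hasCompactSupport.comp_homeomorph
      (Homeomorph.smulOfNeZero ((n : ℝ) + 1)⁻¹ (inv_ne_zero hn.ne'))
  · rw [abs_of_nonneg b.nonneg]; exact b.le_one
  · refine b.one_of_mem_closedBall ?_
    rw [mem_closedBall_zero_iff] at hy ⊢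
    rw [norm_smul, norm_inv, Real.norm_of_nonneg hn.le, inv_mul_le_iff₀ hn]
    simpa [b] using hy
  · have h1 : HasFDerivAt (fun y : RN N => b (((n : ℝ) + 1)⁻¹ • y)) _ y :=
      (hb.differentiable (by simp) _).hasFDerivAt.comp y
        ((hasFDerivAt_id (𝕜 := ℝ) y).const_smul ((n : ℝ) + 1)⁻¹)
    rw [gradient, LinearIsometryEquiv.norm_map, h1.fderiv]
    refine (ContinuousLinearMap.opNorm_comp_le _ _).trans ?_
    rw [div_eq_mul_inv]
    refine mul_le_mul (hC _) ?_ (norm_nonneg _) ((norm_nonneg _).trans (hC 0))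
    rw [norm_smul, norm_inv, Real.norm_of_nonneg hn.le]
    exact mul_le_of_le_one_right (by positivity) ContinuousLinearMap.norm_id_le

/-- Global integrability gives `L¹` convergence of the mollifications of `u` and `G`; the classical
chain rule for the mollifications then passes to the limit, `ψ` being Lipschitz. -/
theorem HasWeakGradient.integral_comp_eq_of_integrable {ψ ψ' : ℝ → ℝ} {C : ℝ}
    (h : HasWeakGradient u G) (hu : Integrable u) (hG : Integrable G)
    (hψ : ∀ t, HasDerivAt ψ (ψ' t) t) (hψ' : Continuous ψ') (hC : ∀ t, |ψ' t| ≤ C)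
    {φ : RN N → ℝ} (hφ : ContDiff ℝ ∞ φ) (hc : HasCompactSupport φ) (v : RN N) :
    ∫ y, ψ (u y) * fderiv ℝ φ y v = -∫ y, φ y * inner ℝ (ψ' (u y) • G y) v := by
  have hC0 : 0 ≤ C := (abs_nonneg _).trans (hC 0)
  have hψc : Continuous ψ := continuous_iff_continuousAt.2 fun t => (hψ t).continuousAt
  have hlip : ∀ s t, ‖ψ s - ψ t‖ ≤ C * ‖s - t‖ := fun s t =>
    convex_univ.norm_image_sub_le_of_norm_hasDerivWithin_le
      (fun t _ => (hψ t).hasDerivWithinAt) (fun t _ => hC t) (mem_univ t) (mem_univ s)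
  set w := fun n => mollify (bumpSeq N n) u with hw
  set K := fun n => mollify (bumpSeq N n) G with hK
  have hws : ∀ n, ContDiff ℝ ∞ (w n) := fun n => contDiff_mollify _ h.locallyIntegrable
  have hKc : ∀ n, Continuous (K n) := fun n =>
    (contDiff_mollify _ h.locallyIntegrable_grad).continuous
  have hd : Continuous fun y => fderiv ℝ φ y v :=
    (hφ.continuous_fderiv (by simp)).clm_apply continuous_const
  have hdc : HasCompactSupport fun y => fderiv ℝ φ y v := hc.fderiv_apply ℝ v
  obtain ⟨A, hA⟩ := hd.bounded_above_of_compact_support hdc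
  obtain ⟨B, hB⟩ := hφ.continuous.bounded_above_of_compact_support hc
  have hDw : ∀ n y, fderiv ℝ (fun y => ψ (w n y)) y v = ψ' (w n y) * inner ℝ (K n y) v :=
    fun n y => by
    have h1 : HasFDerivAt (fun y => ψ (w n y)) _ y :=
      (hψ (w n y)).comp_hasFDerivAt y ((hws n).differentiable (by simp) y).hasFDerivAt
    rw [h1.fderiv]
    simp [hw, hK, h.fderiv_mollify]
  have eqn : ∀ n, ∫ y, ψ (w n y) * fderiv ℝ φ y v =
      -∫ y, φ y * inner ℝ (ψ' (w n y) • K n y) v := fun n => by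
    have hcψ : Continuous fun y => ψ (w n y) := hψc.comp (hws n).continuous
    have hcD : Continuous fun y => fderiv ℝ (fun y => ψ (w n y)) y v := by
      simp only [hDw]
      exact (hψ'.comp (hws n).continuous).mul ((hKc n).inner continuous_const)
    rw [integral_mul_fderiv_eq_neg_fderiv_mul_of_integrable
      ((hcD.mul hφ.continuous).integrable_of_hasCompactSupport hc.mul_left)
      ((hcψ.mul hd).integrable_of_hasCompactSupport hdc.mul_left)
      ((hcψ.mul hφ.continuous).integrable_of_hasCompactSupport hc.mul_left)
      (fun y _ => (hψ _).differentiableAt.comp y ((hws n).differentiable (by simp) y))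
      (fun y _ => hφ.differentiable (by simp) y)]
    congr 1
    refine integral_congr_ae (ae_of_all _ fun y => ?_)
    simp only [hDw, real_inner_smul_left]; ring
  have hL1u := tendsto_lintegral_mollify_sub hu
  have hL1G := tendsto_lintegral_mollify_sub hG
  have t1 : Tendsto (fun n => ∫ y, ψ (w n y) * fderiv ℝ φ y v) atTop
      (𝓝 (∫ y, ψ (u y) * fderiv ℝ φ y v)) := by
    refine tendsto_integral_of_L1 _ ((hψc.comp_aestronglyMeasurable hu.1).mul
      hd.aestronglyMeasurable) (Eventually.of_forall fun n => ((hψc.comp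
      (hws n).continuous).mul hd).integrable_of_hasCompactSupport hdc.mul_left) ?_
    refine tendsto_of_tendsto_of_tendsto_of_le_of_le tendsto_const_nhds
      (h := fun n => ENNReal.ofReal (C * A) * ∫⁻ y, ‖w n y - u y‖ₑ) ?_ (fun n => zero_le)
      (fun n => ?_)
    · simpa using ENNReal.Tendsto.const_mul hL1u (Or.inr ENNReal.ofReal_ne_top)
    · beta_reduce
      rw [← lintegral_const_mul' _ _ ENNReal.ofReal_ne_top]
      refine lintegral_mono fun y => ?_
      rw [← ofReal_norm, ← ofReal_norm, ← ENNReal.ofReal_mul' (norm_nonneg _), Pi.mul_apply,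
        ← sub_mul]
      refine ENNReal.ofReal_le_ofReal ?_
      rw [norm_mul, mul_right_comm]
      exact mul_le_mul (hlip _ _) (hA y) (norm_nonneg _) (by positivity)
  have t2 : Tendsto (fun n => ∫ y, φ y * inner ℝ (ψ' (w n y) • K n y) v) atTop
      (𝓝 (∫ y, φ y * inner ℝ (ψ' (u y) • G y) v)) := by
    -- The mollified gradients `K n` need not have a common majorant. Hence the splitting into a
    -- term with the fixed `G`, treated by dominated convergence, and a term with `K n - G`, which
    -- is small in `L¹`.
    have s1 : Tendsto (fun n => ∫ y, φ y * inner ℝ (ψ' (w n y) • G y) v) atTop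
        (𝓝 (∫ y, φ y * inner ℝ (ψ' (u y) • G y) v)) := by
      refine tendsto_integral_of_dominated_convergence (fun y => B * (C * ‖G y‖ * ‖v‖))
        (fun n => hφ.continuous.aestronglyMeasurable.mul
        (((hψ'.comp (hws n).continuous).aestronglyMeasurable.smul hG.1).inner
          aestronglyMeasurable_const)) ((hG.norm.const_mul C).mul_const _ |>.const_mul B)
        (fun n => ae_of_all _ fun y => ?_) ?_
      · rw [norm_mul]
        refine mul_le_mul (hB y) ((norm_inner_le_norm _ _).trans ?_) (norm_nonneg _)
          ((norm_nonneg _).trans (hB 0))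
        rw [norm_smul]; gcongr; exact hC _
      · filter_upwards [ae_tendsto_mollify h.locallyIntegrable] with y hy
        exact ((((hψ'.tendsto _).comp hy).smul_const (G y)).inner tendsto_const_nhds).const_mul _
    have s2 : Tendsto (fun n => ∫ y, φ y * inner ℝ (ψ' (w n y) • (K n y - G y)) v) atTop
        (𝓝 (∫ _, (0 : ℝ) ∂(volume : Measure (RN N)))) := by
      refine tendsto_integral_of_L1 _ aestronglyMeasurable_const
        (Eventually.of_forall fun n => ?_) ?_
      · have hKG : LocallyIntegrable (fun y => ψ' (w n y) • (K n y - G y)) :=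
          (((integrable_mollify _ hG).sub hG).bdd_smul C
            (hψ'.comp (hws n).continuous).aestronglyMeasurable
            (ae_of_all _ fun y => hC _)).locallyIntegrable
        have := (hKG.integrable_smul_left_of_hasCompactSupport
          hφ.continuous hc).inner_const (𝕜 := ℝ) v
        simpa [real_inner_smul_left] using this
      · refine tendsto_of_tendsto_of_tendsto_of_le_of_le tendsto_const_nhds
          (h := fun n => ENNReal.ofReal (B * (C * ‖v‖)) * ∫⁻ y, ‖K n y - G y‖ₑ) ?_
          (fun n => zero_le) (fun n => ?_)
        · simpa using ENNReal.Tendsto.const_mul hL1G (Or.inr ENNReal.ofReal_ne_top)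
        · beta_reduce
          rw [← lintegral_const_mul' _ _ ENNReal.ofReal_ne_top]
          refine lintegral_mono fun y => ?_
          rw [← ofReal_norm, ← ofReal_norm, ← ENNReal.ofReal_mul' (norm_nonneg _), sub_zero]
          refine ENNReal.ofReal_le_ofReal ?_
          rw [norm_mul, mul_assoc]
          refine mul_le_mul (hB y) ((norm_inner_le_norm _ _).trans ?_) (norm_nonneg _)
            ((norm_nonneg _).trans (hB 0))
          rw [norm_smul, mul_right_comm]; gcongr; exact hC _
    have := s1.add s2
    rw [integral_zero, add_zero] at this
    refine this.congr fun n => ?_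
    have hi : ∀ {F : RN N → RN N}, Integrable F → Integrable fun y =>
        φ y * inner ℝ (ψ' (w n y) • F y) v := fun {F} hF => by
      have hKG : LocallyIntegrable (fun y => ψ' (w n y) • F y) :=
        (hF.bdd_smul C (hψ'.comp (hws n).continuous).aestronglyMeasurable
          (ae_of_all _ fun y => hC _)).locallyIntegrable
      have := (hKG.integrable_smul_left_of_hasCompactSupport
        hφ.continuous hc).inner_const (𝕜 := ℝ) v
      simpa [real_inner_smul_left] using this
    rw [← integral_add (hi hG) (hi (F := fun y => K n y - G y) ((integrable_mollify _ hG).sub hG))]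
    refine integral_congr_ae (ae_of_all _ fun y => ?_)
    simp only [← mul_add, ← inner_add_left, ← smul_add, add_sub_cancel]
  refine tendsto_nhds_unique t1 ?_
  simp only [eqn]
  exact t2.neg

/-- Chain rule for weak gradients. -/
theorem HasWeakGradient.comp {ψ ψ' : ℝ → ℝ} {C : ℝ} (h : HasWeakGradient u G)
    (hψ : ∀ t, HasDerivAt ψ (ψ' t) t) (hψ' : Continuous ψ') (hC : ∀ t, |ψ' t| ≤ C) :
    HasWeakGradient (fun y => ψ (u y)) (fun y => ψ' (u y) • G y) := by
  have hC0 : 0 ≤ C := (abs_nonneg _).trans (hC 0)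
  have hψc : Continuous ψ := continuous_iff_continuousAt.2 fun t => (hψ t).continuousAt
  have hlip : ∀ s t, ‖ψ s - ψ t‖ ≤ C * ‖s - t‖ := fun s t =>
    convex_univ.norm_image_sub_le_of_norm_hasDerivWithin_le
      (fun t _ => (hψ t).hasDerivWithinAt) (fun t _ => hC t) (mem_univ t) (mem_univ s)
  refine ⟨?_, ?_, fun φ hφ hc v => ?_⟩
  · have h1 : LocallyIntegrable (fun y => |ψ 0| + C * ‖u y‖) volume :=
      (locallyIntegrable_const _).add (h.locallyIntegrable.norm_real.smul C)
    refine h1.mono (hψc.comp_aestronglyMeasurable h.locallyIntegrable.aestronglyMeasurable)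
      (ae_of_all _ fun y => ?_)
    rw [Real.norm_of_nonneg (add_nonneg (abs_nonneg _) (mul_nonneg hC0 (norm_nonneg _)))]
    have := hlip (u y) 0
    rw [sub_zero] at this
    calc ‖ψ (u y)‖ = ‖ψ 0 + (ψ (u y) - ψ 0)‖ := by congr 1; ring
      _ ≤ |ψ 0| + C * ‖u y‖ := (norm_add_le _ _).trans (by gcongr; rfl)
  · refine (h.locallyIntegrable_grad.norm_real.smul C).mono
      ((hψ'.comp_aestronglyMeasurable h.locallyIntegrable.aestronglyMeasurable).smul
        h.locallyIntegrable_grad.aestronglyMeasurable) (ae_of_all _ fun y => ?_)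
    change ‖ψ' (u y) • G y‖ ≤ ‖C * ‖G y‖‖
    rw [norm_smul, norm_mul, norm_norm, Real.norm_of_nonneg hC0]
    exact mul_le_mul_of_nonneg_right (hC _) (norm_nonneg _)
  -- Localisation: multiplying `u` by a cutoff equal to one near the support of `φ` makes it and its
  -- gradient integrable without changing either side.
  · obtain ⟨D, χ, hχ⟩ := exists_cutoff N
    obtain ⟨R, hR⟩ := hc.isCompact.isBounded.subset_ball 0
    obtain ⟨n, hn⟩ := exists_nat_ge R
    obtain ⟨c1, c2, -, c3, -⟩ := hχ n
    have hu' := h.smul_cutoff c1 c2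
    have hg : Continuous (gradient (χ n)) :=
      (InnerProductSpace.toDual ℝ (RN N)).symm.continuous.comp (c1.continuous_fderiv (by simp))
    have hgc : HasCompactSupport (gradient (χ n)) :=
      (c2.fderiv ℝ).comp_left (map_zero (InnerProductSpace.toDual ℝ (RN N)).symm)
    have key := hu'.integral_comp_eq_of_integrable
      (h.locallyIntegrable.integrable_smul_left_of_hasCompactSupport c1.continuous c2)
      ((h.locallyIntegrable_grad.integrable_smul_left_of_hasCompactSupport c1.continuous c2).add
        (h.locallyIntegrable.integrable_smul_right_of_hasCompactSupport hg hgc))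
      hψ hψ' hC hφ hc v
    have hball : ∀ y ∈ tsupport φ, χ n y = 1 ∧ gradient (χ n) y = 0 := fun y hy => by
      have hlt : ‖y‖ < n + 1 := by
        have := mem_ball_zero_iff.1 (hR hy); linarith
      refine ⟨c3 y (mem_closedBall_zero_iff.2 hlt.le), ?_⟩
      have hev : χ n =ᶠ[𝓝 y] fun _ => 1 := by
        filter_upwards [Metric.isOpen_ball.mem_nhds (mem_ball_zero_iff.2 hlt)] with z hz
        exact c3 z (Metric.ball_subset_closedBall hz)
      rw [hev.gradient_eq]; simp
    have e1 : ∀ y, ψ (χ n y * u y) * fderiv ℝ φ y v = ψ (u y) * fderiv ℝ φ y v := fun y => by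
      by_cases hy : y ∈ tsupport φ
      · simp [(hball y hy).1]
      · have : fderiv ℝ φ y = 0 := by
          by_contra h0; exact hy (support_fderiv_subset ℝ h0)
        simp [this]
    have e2 : ∀ y, φ y * inner ℝ (ψ' (χ n y * u y) • (χ n y • G y + u y • gradient (χ n) y)) v =
        φ y * inner ℝ (ψ' (u y) • G y) v := fun y => by
      by_cases hy : y ∈ tsupport φ
      · simp [(hball y hy).1, (hball y hy).2]
      · simp [image_eq_zero_of_notMem_tsupport hy]
    simp only [e1, e2] at key
    exact key

/-- Squaring smooths the corner of the positive part at the origin. This provides a `C¹`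
regularisation of `(t - a)⁺`, as the chain rule for weak gradients requires. -/
theorem hasDerivAt_max_zero_sq (t : ℝ) : HasDerivAt (fun t : ℝ => max t 0 ^ 2) (2 * max t 0) t := by
  rcases lt_trichotomy t 0 with ht | rfl | ht
  · refine (hasDerivAt_const t (0 : ℝ)).congr_of_eventuallyEq ?_ |>.congr_deriv ?_
    · filter_upwards [gt_mem_nhds ht] with s hs
      simp [max_eq_right hs.le]
    · simp [max_eq_right ht.le]
  · rw [hasDerivAt_iff_isLittleO]
    have h : (fun s : ℝ => s ^ 2) =o[𝓝 0] fun s => s := by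
      simpa using Asymptotics.isLittleO_pow_id (𝕜 := ℝ) one_lt_two
    refine (Asymptotics.IsBigO.of_bound 1 (Eventually.of_forall fun s => ?_)).trans_isLittleO
      (by simpa using h)
    have h1 : |max s 0| ≤ |s| := by
      rcases le_total s 0 with hs | hs <;> simp [hs]
    simpa using pow_le_pow_left₀ (abs_nonneg _) h1 2
  · refine (hasDerivAt_pow 2 t).congr_of_eventuallyEq ?_ |>.congr_deriv ?_
    · filter_upwards [lt_mem_nhds ht] with s hs
      simp [max_eq_left hs.le]
    · simp [max_eq_left ht.le]

/-- The weak gradient of the truncation `(u - a)⁺`. -/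
theorem HasWeakGradient.posPart_sub (h : HasWeakGradient u G) (a : ℝ) :
    HasWeakGradient (fun y => max (u y - a) 0) ({y | a < u y}.indicator G) := by
  let ε : ℕ → ℝ := fun n => 1 / ((n : ℝ) + 1)
  have hε : ∀ n, 0 < ε n := fun n => by positivity
  have hεt : Tendsto ε atTop (𝓝 0) := tendsto_one_div_add_atTop_nhds_zero_nat
  -- The derivative of `r n` lies in `[0, 1]`, vanishes for `t ≤ a` including `t = a`, and tends to
  -- `1` for `t > a`; so the limiting gradient is zero on the level set `u = a`.
  let r : ℕ → ℝ → ℝ := fun n t => √(max (t - a) 0 ^ 2 + ε n ^ 2)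
  have hr : ∀ n t, 0 < r n t := fun n t => Real.sqrt_pos.2 (by have := hε n; positivity)
  have hmr : ∀ n t, max (t - a) 0 ≤ r n t := fun n t => by
    refine Real.le_sqrt_of_sq_le ?_
    have := sq_nonneg (ε n); linarith
  have hder : ∀ n t, HasDerivAt (fun t => r n t - ε n) (max (t - a) 0 / r n t) t := fun n t => by
    have h1 : HasDerivAt (fun t => max (t - a) 0 ^ 2 + ε n ^ 2) (2 * max (t - a) 0) t := by
      have := (hasDerivAt_max_zero_sq (t - a)).comp t ((hasDerivAt_id t).sub_const a)
      simpa using this.add_const (ε n ^ 2)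
    refine ((h1.sqrt (by have := hε n; positivity)).sub_const (ε n)).congr_deriv ?_
    rw [mul_div_mul_left _ _ two_ne_zero]
  have hcomp : ∀ n, HasWeakGradient (fun y => r n (u y) - ε n)
      (fun y => (max (u y - a) 0 / r n (u y)) • G y) := fun n => by
    refine h.comp (ψ' := fun t => max (t - a) 0 / r n t) (C := 1) (hder n) ?_ fun t => ?_
    · exact Continuous.div (by fun_prop) (by fun_prop) fun t => (hr n t).ne'
    · rw [abs_of_nonneg (div_nonneg (le_max_right _ _) (hr n t).le), div_le_one (hr n t)]
      exact hmr n t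
  have hr0 : ∀ t, Tendsto (fun n => r n t) atTop (𝓝 (max (t - a) 0)) := fun t => by
    have := ((tendsto_const_nhds (x := max (t - a) 0 ^ 2)).add (hεt.pow 2)).sqrt
    simpa [Real.sqrt_sq (le_max_right (t - a) 0)] using this
  refine HasWeakGradient.of_tendsto hcomp (b := fun y => ‖u y‖ + ‖a‖) (B := fun y => ‖G y‖)
    (h.locallyIntegrable.norm_real.add (locallyIntegrable_const _)) h.locallyIntegrable_grad.norm_real
    (fun n => ae_of_all _ fun y => ?_) (fun n => ae_of_all _ fun y => ?_)
    (ae_of_all _ fun y => ?_) (ae_of_all _ fun y => ?_)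
  · have h1 : ε n ≤ r n (u y) := Real.le_sqrt_of_sq_le (by
      have := sq_nonneg (max (u y - a) 0); linarith)
    have h2 : r n (u y) ≤ max (u y - a) 0 + ε n := by
      refine Real.sqrt_le_iff.2 ⟨add_nonneg (le_max_right _ _) (hε n).le, ?_⟩
      nlinarith [mul_nonneg (le_max_right (u y - a) 0) (hε n).le]
    rw [Real.norm_of_nonneg (by linarith)]
    have h3 : max (u y - a) 0 ≤ ‖u y‖ + ‖a‖ :=
      max_le ((Real.le_norm_self _).trans (norm_sub_le _ _)) (by positivity)
    linarith
  · rw [norm_smul, Real.norm_of_nonneg (div_nonneg (le_max_right _ _) (hr n _).le)]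
    exact mul_le_of_le_one_left (norm_nonneg _) ((div_le_one (hr n _)).2 (hmr n _))
  · simpa using (hr0 (u y)).sub hεt
  · by_cases hy : a < u y
    · rw [indicator_of_mem (show y ∈ {y | a < u y} from hy)]
      have hpos : 0 < max (u y - a) 0 := lt_max_of_lt_left (sub_pos.2 hy)
      have := ((tendsto_const_nhds (x := max (u y - a) 0)).div (hr0 (u y)) hpos.ne').smul_const
        (G y)
      simpa [div_self hpos.ne'] using this
    · rw [indicator_of_notMem (show y ∉ {y | a < u y} from hy)]
      have : max (u y - a) 0 = 0 := max_eq_right (by linarith [not_lt.1 hy])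
      simp [this]

/-- The weak gradient of the truncation of `u` between the levels `a` and `b`. -/
theorem HasWeakGradient.truncate (h : HasWeakGradient u G) {a b : ℝ} (hab : a ≤ b) :
    HasWeakGradient (fun y => min (max (u y - a) 0) (b - a))
      ({y | a < u y ∧ u y ≤ b}.indicator G) := by
  -- The truncation is `(u - a)⁺ - (u - b)⁺`.
  refine ((h.posPart_sub a).sub (h.posPart_sub b)).congr_ae (ae_of_all _ fun y => ?_)
    (ae_of_all _ fun y => ?_)
  · rcases le_total (u y) a with h1 | h1 <;> rcases le_total (u y) b with h2 | h2 <;>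
      simp only [max_def, min_def] <;> split_ifs <;> linarith
  · simp only [indicator, mem_ofPred_eq]
    by_cases h1 : a < u y <;> by_cases h2 : b < u y
    · simp [h1, h2]
    · simp [h1, h2, not_lt.1 h2]
    · exact absurd (hab.trans_lt h2) h1
    · simp [h1, h2]

end Calculus

end MinimalCost

namespace MinimalCost

/-! ### Sobolev inequality -/

section Sobolev

/-- The identification of `ℝ` with `ℝ^1`. -/
noncomputable def lineIso : ℝ ≃ₗᵢ[ℝ] RN 1 where
  toFun t := EuclideanSpace.single 0 t
  invFun y := y 0
  map_add' s t := by ext i; fin_cases i; simp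
  map_smul' c t := by ext i; simp
  left_inv t := by simp
  right_inv y := by ext i; fin_cases i; simp
  norm_map' t := by simp

theorem measurePreserving_lineIso : MeasurePreserving lineIso :=
  lineIso.measurePreserving

/-- The Sobolev conjugate exponent of `1` in dimension `N`. -/
noncomputable def sobolevExponent (N : ℕ) : ℝ≥0∞ :=
  if N = 1 then ⊤ else ENNReal.ofReal ((N : ℝ) / (N - 1))

theorem one_le_sobolevExponent {N : ℕ} (hN : 1 ≤ N) : 1 ≤ sobolevExponent N := by
  unfold sobolevExponent
  split_ifs with h
  · exact le_top
  · have h2 : (2 : ℝ) ≤ N := by exact_mod_cast (by omega : 2 ≤ N)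
    rw [ENNReal.one_le_ofReal, one_le_div (by linarith)]
    linarith

theorem one_sub_inv_sobolevExponent {N : ℕ} (hN : 1 ≤ N) :
    1 / (1 : ℝ≥0∞).toReal - 1 / (sobolevExponent N).toReal = 1 / N := by
  unfold sobolevExponent
  split_ifs with h
  -- For `N = 1` the exponent is `⊤`, and the conventions `⊤.toReal = 0` and `1 / 0 = 0` give it
  -- reciprocal zero, as desired.
  · simp [h]
  · have h2 : (2 : ℝ) ≤ N := by exact_mod_cast (by omega : 2 ≤ N)
    rw [ENNReal.toReal_ofReal (div_nonneg (by linarith) (by linarith))]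
    field_simp
    simp

/-- In dimension one the supremum is bounded by the integral of the derivative; in higher dimension
this is the Gagliardo–Nirenberg–Sobolev inequality with exponent one. -/
theorem exists_eLpNorm_le_of_contDiff {N : ℕ} (hN : 1 ≤ N) :
    ∃ C : ℝ≥0∞, C ≠ ⊤ ∧ ∀ w : RN N → ℝ, ContDiff ℝ 1 w → HasCompactSupport w →
      eLpNorm w (sobolevExponent N) volume ≤ C * ∫⁻ y, ‖fderiv ℝ w y‖ₑ := by
  rcases eq_or_ne N 1 with rfl | h1
  · refine ⟨1, by simp, fun w hw hc => ?_⟩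
    rw [sobolevExponent, if_pos rfl, one_mul, eLpNorm_exponent_top]
    refine eLpNormEssSup_le_of_ae_enorm_bound (ae_of_all _ fun y => ?_)
    have hw' : ContDiff ℝ 1 fun t => w (lineIso t) := hw.comp lineIso.contDiff
    have hc' : HasCompactSupport fun t => w (lineIso t) :=
      hc.comp_homeomorph lineIso.toHomeomorph
    obtain ⟨t, rfl⟩ := lineIso.surjective y
    refine (hc'.enorm_le_lintegral_Ici_deriv hw' t).trans ((setLIntegral_le_lintegral _ _).trans ?_)
    rw [← measurePreserving_lineIso.lintegral_comp_emb lineIso.toHomeomorph.measurableEmbedding]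
    refine lintegral_mono fun s => ?_
    have h1 : HasFDerivAt (fun t => w (lineIso t)) _ s :=
      (hw.differentiable (by simp) (lineIso s)).hasFDerivAt.comp s
        lineIso.toContinuousLinearEquiv.hasFDerivAt
    rw [h1.hasDerivAt.deriv]
    refine (ContinuousLinearMap.le_opENorm (fderiv ℝ w (lineIso s)) (lineIso 1)).trans ?_
    rw [← ofReal_norm (lineIso 1), lineIso.norm_map]
    simp
  · have h2 : 2 ≤ N := by omega
    have h2' : (2 : ℝ) ≤ N := by exact_mod_cast h2
    have hp : NNReal.HolderConjugate (Module.finrank ℝ (RN N) : NNReal)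
        (Real.toNNReal ((N : ℝ) / (N - 1))) := by
      rw [finrank_euclideanSpace_fin,
        NNReal.holderConjugate_iff_eq_conjExponent (by exact_mod_cast h2)]
      rw [← NNReal.coe_inj, Real.coe_toNNReal _ (div_nonneg (by linarith) (by linarith)),
        NNReal.coe_div, NNReal.coe_sub (by exact_mod_cast hN)]
      simp
    refine ⟨eLpNormLESNormFDerivOneConst (volume : Measure (RN N))
      (Real.toNNReal ((N : ℝ) / (N - 1)) : ℝ), ENNReal.coe_ne_top, fun w hw hc => ?_⟩
    rw [sobolevExponent, if_neg h1, ← eLpNorm_one_eq_lintegral_enorm]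
    exact eLpNorm_le_eLpNorm_fderiv_one volume hw hc hp

/-- Gagliardo–Nirenberg–Sobolev inequality for integrable functions. -/
theorem exists_eLpNorm_le_of_hasWeakGradient {N : ℕ} (hN : 1 ≤ N) :
    ∃ C : ℝ≥0∞, C ≠ ⊤ ∧ ∀ (u : RN N → ℝ) (G : RN N → RN N), HasWeakGradient u G →
      Integrable u → eLpNorm u (sobolevExponent N) volume ≤ C * ∫⁻ y, ‖G y‖ₑ := by
  obtain ⟨C, hC, hS⟩ := exists_eLpNorm_le_of_contDiff hN
  -- Compact support survives mollification. Fatou's lemma handles the left side, and the `L¹`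
  -- contraction property of mollification the right side.
  have hcpt : ∀ (u : RN N → ℝ) (G : RN N → RN N), HasWeakGradient u G → Integrable u →
      Integrable G → HasCompactSupport u →
      eLpNorm u (sobolevExponent N) volume ≤ C * ∫⁻ y, ‖G y‖ₑ := by
    intro u G h hu hG hc
    refine (Lp.eLpNorm_lim_le_liminf_eLpNorm
      (fun n => (integrable_mollify (bumpSeq N n) hu).aestronglyMeasurable) u
      (ae_tendsto_mollify h.locallyIntegrable)).trans ?_
    refine liminf_le_of_le (by isBoundedDefault) fun b hb => ?_
    obtain ⟨n, hn⟩ := hb.exists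
    refine hn.trans ((hS _ ((contDiff_mollify _ h.locallyIntegrable).of_le (by simp))
      (hasCompactSupport_mollify _ hc)).trans (mul_le_mul' le_rfl ?_))
    refine le_trans (lintegral_mono (g := fun y => ‖mollify (bumpSeq N n) G y‖ₑ) fun y => le_of_eq ?_)
      (lintegral_enorm_mollify_le (bumpSeq N n) hG)
    have : fderiv ℝ (mollify (bumpSeq N n) u) y =
        InnerProductSpace.toDual ℝ (RN N) (mollify (bumpSeq N n) G y) := by
      ext v; rw [h.fderiv_mollify]; simp
    rw [this, ← ofReal_norm, LinearIsometryEquiv.norm_map, ofReal_norm]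
  -- The added `1` makes the constant nonzero, so that the right side is infinite when the gradient
  -- is not integrable.
  refine ⟨C + 1, by finiteness, fun u G h hu => ?_⟩
  rcases eq_or_ne (∫⁻ y, ‖G y‖ₑ) ⊤ with htop | htop
  · rw [htop, ENNReal.mul_top (by simp)]; exact le_top
  have hG : Integrable G := ⟨h.locallyIntegrable_grad.aestronglyMeasurable, htop.lt_top⟩
  obtain ⟨D, χ, hχ⟩ := exists_cutoff N
  -- The term created by differentiating the cutoff is at most `D / (n + 1)` times the `L¹` norm of
  -- `u`, and disappears in the limit.
  have hlim : Tendsto (fun n : ℕ => C * ((∫⁻ y, ‖G y‖ₑ) +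
      ENNReal.ofReal (D / (n + 1)) * ∫⁻ y, ‖u y‖ₑ)) atTop (𝓝 (C * ∫⁻ y, ‖G y‖ₑ)) := by
    have h1 : Tendsto (fun n : ℕ => ENNReal.ofReal (D / ((n : ℝ) + 1))) atTop (𝓝 0) := by
      have := (tendsto_one_div_add_atTop_nhds_zero_nat (𝕜 := ℝ)).const_mul D
      simpa [mul_one_div, div_eq_mul_inv] using ENNReal.tendsto_ofReal this
    have h2 := ENNReal.Tendsto.mul_const h1 (b := ∫⁻ y, ‖u y‖ₑ) (Or.inr hu.2.ne)
    have h3 := ENNReal.Tendsto.const_mul (a := C)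
      ((tendsto_const_nhds (x := ∫⁻ y, ‖G y‖ₑ)).add h2) (Or.inr hC)
    simpa using h3
  refine (Lp.eLpNorm_lim_le_liminf_eLpNorm (f := fun n y => χ n y * u y)
    (fun n => ((hχ n).1.continuous.aestronglyMeasurable.mul hu.1)) u
    (ae_of_all _ fun y => ?_)).trans ?_
  · obtain ⟨n, hn⟩ := exists_nat_ge ‖y‖
    refine tendsto_const_nhds.congr' ?_
    filter_upwards [eventually_ge_atTop n] with k hk
    rw [(hχ k).2.2.2.1 y, one_mul]
    rw [mem_closedBall_zero_iff]
    have : (n : ℝ) ≤ k := by exact_mod_cast hk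
    linarith
  · calc _ ≤ liminf (fun n : ℕ => C * ((∫⁻ y, ‖G y‖ₑ) +
          ENNReal.ofReal (D / (n + 1)) * ∫⁻ y, ‖u y‖ₑ)) atTop := by
          refine liminf_le_liminf (Eventually.of_forall fun n => ?_)
          obtain ⟨c1, c2, c3, -, c5⟩ := hχ n
          have hg : Continuous (gradient (χ n)) :=
            (InnerProductSpace.toDual ℝ (RN N)).symm.continuous.comp
              (c1.continuous_fderiv (by simp))
          have hgc : HasCompactSupport (gradient (χ n)) :=
            (c2.fderiv ℝ).comp_left (map_zero (InnerProductSpace.toDual ℝ (RN N)).symm)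
          have i0 := h.locallyIntegrable.integrable_smul_left_of_hasCompactSupport c1.continuous c2
          have i1 := h.locallyIntegrable_grad.integrable_smul_left_of_hasCompactSupport
            c1.continuous c2
          have i2 := h.locallyIntegrable.integrable_smul_right_of_hasCompactSupport hg hgc
          refine (hcpt _ _ (h.smul_cutoff c1 c2) i0 (i1.add i2) c2.mul_right).trans ?_
          gcongr
          rw [← lintegral_const_mul' _ _ ENNReal.ofReal_ne_top, ← lintegral_add_left' hG.1.enorm]
          refine lintegral_mono fun y => (enorm_add_le _ _).trans (add_le_add ?_ ?_)
          · rw [enorm_smul]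
            refine mul_le_of_le_one_left zero_le ?_
            rw [← ofReal_norm, ← ENNReal.ofReal_one]
            exact ENNReal.ofReal_le_ofReal (c3 y)
          · rw [enorm_smul, mul_comm]
            gcongr
            rw [← ofReal_norm]
            exact ENNReal.ofReal_le_ofReal (c5 y)
      _ = C * ∫⁻ y, ‖G y‖ₑ := hlim.liminf_eq
      _ ≤ _ := by gcongr; exact le_self_add

/-- Sobolev inequality on sets of finite measure. -/
theorem exists_lintegral_le_of_hasWeakGradient {N : ℕ} (hN : 1 ≤ N) :
    ∃ C : ℝ, 0 ≤ C ∧ ∀ (u : RN N → ℝ) (G : RN N → RN N) (A : Set (RN N)), HasWeakGradient u G →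
      Integrable u →
      ∫⁻ y in A, ‖u y‖ₑ ≤ ENNReal.ofReal C * volume A ^ (1 / N : ℝ) * ∫⁻ y, ‖G y‖ₑ := by
  obtain ⟨C, hC, hS⟩ := exists_eLpNorm_le_of_hasWeakGradient hN
  refine ⟨C.toReal, ENNReal.toReal_nonneg, fun u G A h hu => ?_⟩
  -- Hölder's inequality on `A`: the gap between the reciprocal exponents is `1 / N` in every
  -- dimension.
  have h1 := eLpNorm_le_eLpNorm_mul_rpow_measure_univ (one_le_sobolevExponent hN)
    (hu.1.restrict (s := A))
  rw [one_sub_inv_sobolevExponent hN, eLpNorm_one_eq_lintegral_enorm,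
    Measure.restrict_apply_univ] at h1
  rw [ENNReal.ofReal_toReal hC]
  calc _ ≤ _ := h1
    _ ≤ (C * ∫⁻ y, ‖G y‖ₑ) * volume A ^ (1 / N : ℝ) := by
        gcongr
        exact (eLpNorm_mono_measure _ Measure.restrict_le_self).trans (hS u G h hu)
    _ = _ := by ring

end Sobolev

end MinimalCost

namespace MinimalCost

/-! ### Lower bound -/

section Lower

/-- The bootstrap behind the lower bound. Here `e` is the energy, `S` the measure of `{a < u ≤ b}`,
`A` that of `{u > b}` and `J` the integral of `(u - b)⁺`. One gets in turn `S ≤ m / a`, `A ≤ K2 m`,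
and `J ≤ C τ (K3 m + (β / α) J)` with `τ = (K2 m)^(1/N)`. As `τ → 0`, the last `J` is absorbed and
`J = o(m)`, which costs at most the gap between `c` and `c'`. -/
theorem lowerBound_real_ineq {N : ℕ} (hN : 1 ≤ N) {α β C a b c c' : ℝ} (hα : 0 < α) (hβ : 0 < β)
    (hC : 0 ≤ C) (ha : 0 < a) (hab : a < b) (hc' : 0 < c') (hcc : c < c') :
    ∀ᶠ m in 𝓝[>] (0 : ℝ), ∀ e A S J : ℝ, 0 ≤ e → 0 ≤ A → 0 ≤ S → 0 ≤ J → e ≤ c' * m →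
      a * S ≤ e / c' →
      (b - a) * A ≤ C * A ^ (1 / N : ℝ) * (S + (e + β * (e / c')) / α) →
      J ≤ C * A ^ (1 / N : ℝ) * (A + (e + β * (J + b * A)) / α) →
      m ≤ e / c' + 2 * J → c * m ≤ e := by
  set K1 := 1 / a + (c' + β) / α with hK1
  have hK1p : 0 ≤ K1 := by positivity
  set K2 := 2 * C * K1 / (b - a) with hK2
  have hba : 0 < b - a := sub_pos.2 hab
  have hb : 0 < b := ha.trans hab
  have hK2p : 0 ≤ K2 := by positivity
  set K3 := K2 + (c' + β * b * K2) / α with hK3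
  have hK3p : 0 ≤ K3 := by positivity
  have hNp : 0 < (1 / N : ℝ) := by
    have : (0 : ℝ) < N := by exact_mod_cast hN
    positivity
  have t0 : Tendsto (fun m : ℝ => (K2 * m) ^ (1 / N : ℝ)) (𝓝[>] 0) (𝓝 0) := by
    have : Continuous fun m : ℝ => (K2 * m) ^ (1 / N : ℝ) :=
      (continuous_const.mul continuous_id).rpow_const fun _ => Or.inr hNp.le
    have h := (this.tendsto 0).mono_left (nhdsWithin_le_nhds (s := Ioi 0))
    simpa only [mul_zero, Real.zero_rpow hNp.ne'] using h
  have t1 : Tendsto (fun m : ℝ => C * K1 * m) (𝓝[>] 0) (𝓝 0) := by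
    have : Continuous fun m : ℝ => C * K1 * m := by fun_prop
    have h := (this.tendsto 0).mono_left (nhdsWithin_le_nhds (s := Ioi 0))
    simpa using h
  have t2 := t0.const_mul (C * (β / α))
  have t3 := t0.const_mul (4 * C * K3 * c')
  rw [mul_zero] at t2 t3
  filter_upwards [self_mem_nhdsWithin, t1.eventually_le_const (half_pos hba),
    t2.eventually_le_const (half_pos one_pos), t3.eventually_le_const (sub_pos.2 hcc)]
    with m hm h1 h2 h3 e A S J he hA hS hJ hem f1 f2 f3 f4
  replace hm : 0 < m := hm
  have hec : e / c' ≤ m := by rw [div_le_iff₀ hc']; linarith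
  have hSm : S ≤ m / a := by rw [le_div_iff₀ ha]; linarith
  have hX : S + (e + β * (e / c')) / α ≤ K1 * m := by
    have : (e + β * (e / c')) / α ≤ (c' * m + β * m) / α := by gcongr
    calc S + (e + β * (e / c')) / α ≤ m / a + (c' * m + β * m) / α := add_le_add hSm this
      _ = K1 * m := by rw [hK1]; field_simp
  -- A linear majorant suffices for a first bound on `A` and works uniformly in `N`, including `N =
  -- 1`: its `A` term carries the factor `C K1 m`, which is small enough to be absorbed on the left.
  have hA1 : A ^ (1 / N : ℝ) ≤ 1 + A := by
    rcases le_total A 1 with h | h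
    · have := Real.rpow_le_one hA h hNp.le
      linarith
    · have hN1 : (1 / N : ℝ) ≤ 1 := by
        rw [div_le_one (by exact_mod_cast hN)]; exact_mod_cast hN
      have := Real.rpow_le_rpow_of_exponent_le h hN1
      rw [Real.rpow_one] at this
      linarith
  have hA2 : A ≤ K2 * m := by
    have h4 : (b - a) * A ≤ C * (1 + A) * (K1 * m) := by
      refine f2.trans ?_
      gcongr
    have h5 : C * K1 * m * A ≤ (b - a) / 2 * A := by gcongr
    rw [hK2, div_mul_eq_mul_div, le_div_iff₀ hba]
    linarith [mul_add C 1 A]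
  set τ := (K2 * m) ^ (1 / N : ℝ) with hτ
  have hτ0 : 0 ≤ τ := by positivity
  have hAτ : A ^ (1 / N : ℝ) ≤ τ := Real.rpow_le_rpow hA hA2 hNp.le
  have hJ1 : J ≤ C * τ * (K3 * m + β / α * J) := by
    refine f3.trans ?_
    have : A + (e + β * (J + b * A)) / α ≤ K3 * m + β / α * J := by
      calc A + (e + β * (J + b * A)) / α ≤ K2 * m + (c' * m + β * (J + b * (K2 * m))) / α := by
            gcongr
        _ = K3 * m + β / α * J := by rw [hK3]; field_simp; ring
    gcongr
  have hJ2 : J ≤ 2 * C * τ * K3 * m := by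
    have : C * (β / α) * τ * J ≤ 1 / 2 * J := by gcongr
    linarith
  have hfin : 4 * C * K3 * c' * τ * m ≤ (c' - c) * m := by gcongr
  have h6 : c' * m ≤ e + 2 * c' * J := by
    have := mul_le_mul_of_nonneg_left f4 hc'.le
    have h7 : c' * (e / c') = e := by field_simp
    linarith [mul_add c' (e / c') (2 * J)]
  have h8 : c' * J ≤ c' * (2 * C * τ * K3 * m) := by gcongr
  linarith

variable {N : ℕ}

/-- For small `ξ` this is the definition of the lower limit. For `‖ξ‖ ≥ r` coercivity gives at least
`α r^p - β t`, which exceeds `c t` as soon as `t < α r^p / (β + c)`. -/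
theorem exists_le_of_lt_lowerSlope
    {f : RN N → ℝ → RN N → ℝ≥0∞} (hf : HypCompact f) (x : RN N) {c : ℝ} (hc : 0 < c)
    (h : ENNReal.ofReal c < lowerSlope (Ioi 0) f x) :
    ∃ d > 0, ∀ t, 0 < t → t < d → ∀ ξ, ENNReal.ofReal (c * t) ≤ f x t ξ := by
  obtain ⟨α, β, p, hα, hβ, hp, hf⟩ := hf
  have h1 := eventually_lt_of_lt_liminf h
  have h2 : ∀ᶠ q in 𝓝[>] (0 : ℝ) ×ˢ 𝓝 (0 : RN N),
      ENNReal.ofReal c < f x q.1 q.2 / ENNReal.ofReal |q.1| :=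
    ((tendsto_const_nhds (x := x)).prodMk tendsto_id).eventually h1
  rw [eventually_prod_iff] at h2
  obtain ⟨P, hP, Q, hQ, hPQ⟩ := h2
  obtain ⟨d1, hd1, hd1'⟩ := mem_nhdsGT_iff_exists_Ioo_subset.1 hP
  obtain ⟨r, hr, hr'⟩ := Metric.eventually_nhds_iff.1 hQ
  have hrp : 0 < α * r ^ p := mul_pos hα (Real.rpow_pos_of_pos hr p)
  refine ⟨min d1 (α * r ^ p / (β + c)), lt_min hd1 (by positivity), fun t ht htd ξ => ?_⟩
  rw [lt_min_iff] at htd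
  rcases lt_or_ge ‖ξ‖ r with hξ | hξ
  · have h3 := hPQ (hd1' ⟨ht, htd.1⟩) (hr' (by simpa using hξ))
    simp only [abs_of_pos ht] at h3
    rw [ENNReal.lt_div_iff_mul_lt (Or.inl (by simpa using ht)) (Or.inl ENNReal.ofReal_ne_top),
      ← ENNReal.ofReal_mul hc.le] at h3
    exact h3.le
  · refine le_trans (ENNReal.ofReal_le_ofReal ?_) (hf x t ξ)
    have h4 : r ^ p ≤ ‖ξ‖ ^ p := Real.rpow_le_rpow hr.le hξ (by linarith)
    have h5 : t * (β + c) < α * r ^ p := (lt_div_iff₀ (by positivity)).1 htd.2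
    have h6 : α * r ^ p ≤ α * ‖ξ‖ ^ p := by gcongr
    rw [abs_of_pos ht]
    linarith

/-- From `|G| ≤ 1 + |G|^p` and coercivity; the constant `1` is responsible for the term `volume T`.
It converts the energy into the `L¹` gradient bound that the Sobolev inequality takes. -/
theorem setLIntegral_enorm_grad_le {f : RN N → ℝ → RN N → ℝ≥0∞} {α β p : ℝ} (hα : 0 < α)
    (hβ : 0 < β) (hp : 1 < p)
    (hf : ∀ x u ξ, ENNReal.ofReal (α * ‖ξ‖ ^ p - β * |u|) ≤ f x u ξ) (x : RN N)
    {u : RN N → ℝ} (hu : Measurable u) (G : RN N → RN N) (T : Set (RN N)) :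
    ∫⁻ y in T, ‖G y‖ₑ ≤ volume T +
      ((∫⁻ y, f x (u y) (G y)) + ENNReal.ofReal β * ∫⁻ y in T, ‖u y‖ₑ) / ENNReal.ofReal α := by
  have hpt : ∀ y, ‖G y‖ₑ ≤ 1 + (f x (u y) (G y) + ENNReal.ofReal β * ‖u y‖ₑ) * (ENNReal.ofReal α)⁻¹ :=
    fun y => by
    have h1 : ‖G y‖ ≤ 1 + ‖G y‖ ^ p := by
      rcases le_total ‖G y‖ 1 with h | h
      · have := Real.rpow_nonneg (norm_nonneg (G y)) p; linarith
      · have := Real.rpow_le_rpow_of_exponent_le h hp.le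
        rw [Real.rpow_one] at this; linarith
    have h2 : ENNReal.ofReal (α * ‖G y‖ ^ p) ≤ f x (u y) (G y) + ENNReal.ofReal β * ‖u y‖ₑ := by
      calc ENNReal.ofReal (α * ‖G y‖ ^ p)
          = ENNReal.ofReal ((α * ‖G y‖ ^ p - β * |u y|) + β * |u y|) := by congr 1; ring
        _ ≤ _ := ENNReal.ofReal_add_le.trans (add_le_add (hf x _ _) (le_of_eq ?_))
      rw [ENNReal.ofReal_mul hβ.le, ← ofReal_norm, Real.norm_eq_abs]
    rw [← div_eq_mul_inv]
    calc ‖G y‖ₑ = ENNReal.ofReal ‖G y‖ := (ofReal_norm _).symm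
      _ ≤ ENNReal.ofReal (1 + ‖G y‖ ^ p) := ENNReal.ofReal_le_ofReal h1
      _ = 1 + ENNReal.ofReal (‖G y‖ ^ p) := by
          rw [ENNReal.ofReal_add zero_le_one (by positivity), ENNReal.ofReal_one]
      _ ≤ _ := by
          gcongr
          rw [ENNReal.le_div_iff_mul_le (Or.inl (by simpa using hα))
            (Or.inl ENNReal.ofReal_ne_top), mul_comm, ← ENNReal.ofReal_mul hα.le]
          exact h2
  calc ∫⁻ y in T, ‖G y‖ₑ
      ≤ ∫⁻ y in T, 1 + (f x (u y) (G y) + ENNReal.ofReal β * ‖u y‖ₑ) * (ENNReal.ofReal α)⁻¹ :=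
        lintegral_mono hpt
    _ = volume T + (∫⁻ y in T, f x (u y) (G y) + ENNReal.ofReal β * ‖u y‖ₑ) *
          (ENNReal.ofReal α)⁻¹ := by
        rw [lintegral_add_left measurable_const,
          lintegral_mul_const' _ _ (by simpa using hα)]
        simp
    _ = volume T + ((∫⁻ y in T, f x (u y) (G y)) + ENNReal.ofReal β * ∫⁻ y in T, ‖u y‖ₑ) *
          (ENNReal.ofReal α)⁻¹ := by
        rw [lintegral_add_right _ (hu.enorm.const_mul _),
          lintegral_const_mul' _ _ ENNReal.ofReal_ne_top]
    _ ≤ _ := by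
        rw [← div_eq_mul_inv]
        gcongr
        exact Measure.restrict_le_self

end Lower

end MinimalCost

namespace MinimalCost

section Lower

variable {N : ℕ}

theorem setLIntegral_enorm_grad_le_ofReal {f : RN N → ℝ → RN N → ℝ≥0∞} {α β p : ℝ} (hα : 0 < α)
    (hβ : 0 < β) (hp : 1 < p)
    (hf : ∀ x u ξ, ENNReal.ofReal (α * ‖ξ‖ ^ p - β * |u|) ≤ f x u ξ) (x : RN N)
    {u : RN N → ℝ} (hu : Measurable u) (hi : Integrable u) (G : RN N → RN N) {e : ℝ} (he : 0 ≤ e)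
    (hE : ∫⁻ y, f x (u y) (G y) = ENNReal.ofReal e) {T : Set (RN N)} (hT : volume T ≠ ⊤) :
    ∫⁻ y in T, ‖G y‖ₑ ≤
      ENNReal.ofReal (volume.real T + (e + β * ∫ y in T, |u y|) / α) := by
  have hI : 0 ≤ ∫ y in T, |u y| := integral_nonneg fun y => abs_nonneg _
  refine (setLIntegral_enorm_grad_le hα hβ hp hf x hu G T).trans (le_of_eq ?_)
  rw [hE, ← ofReal_integral_norm_eq_lintegral_enorm hi.restrict, ← ENNReal.ofReal_mul hβ.le,
    ← ENNReal.ofReal_add he (by positivity), ← ENNReal.ofReal_div_of_pos hα,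
    ENNReal.ofReal_add measureReal_nonneg (by positivity), ofReal_measureReal hT]
  rfl

/-- Values in `(0, d)` pay at least `c'` per unit of mass. For a competitor of energy below `c m`,
two applications of the Sobolev inequality show that the mass at heights at least `d` is too small
to matter. The threshold on `m` does not depend on the competitor. -/
theorem eventually_le_lintegral (hN : 1 ≤ N) {f : RN N → ℝ → RN N → ℝ≥0∞} (hf : HypCompact f)
    (x : RN N) {c c' d : ℝ} (hc' : 0 < c') (hcc : c < c') (hd : 0 < d)
    (hfd : ∀ t, 0 < t → t < d → ∀ ξ, ENNReal.ofReal (c' * t) ≤ f x t ξ) :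
    ∀ᶠ m in 𝓝[>] (0 : ℝ), ∀ (u : RN N → ℝ) (G : RN N → RN N), Measurable u →
      HasWeakGradient u G → Integrable u → ∫ y, u y = m →
      ENNReal.ofReal (c * m) ≤ ∫⁻ y, f x (u y) (G y) := by
  obtain ⟨α, β, p, hα, hβ, hp, hf⟩ := hf
  obtain ⟨C, hC, hS⟩ := exists_lintegral_le_of_hasWeakGradient hN
  -- With `b = d / 2`, a value `u ≥ d` satisfies `u ≤ 2 (u - b)`, so twice the integral of `(u -
  -- b)⁺` dominates the mass above `d`. The level `a` only has to lie in `(0, b)`.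
  set b := d / 2 with hb
  set a := d / 4 with ha
  have hbp : 0 < b := by positivity
  have hap : 0 < a := by positivity
  have hab : a < b := by rw [ha, hb]; linarith
  filter_upwards [lowerBound_real_ineq hN hα hβ hC hap hab hc' hcc, self_mem_nhdsWithin]
    with m hm hmp u G hu h hi hum
  replace hmp : 0 < m := hmp
  by_contra hlt
  rw [not_le] at hlt
  set e := (∫⁻ y, f x (u y) (G y)).toReal with he
  have he0 : 0 ≤ e := ENNReal.toReal_nonneg
  have hE : ∫⁻ y, f x (u y) (G y) = ENNReal.ofReal e :=
    (ENNReal.ofReal_toReal (hlt.trans ENNReal.ofReal_lt_top).ne).symm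
  rw [hE] at hlt
  have hlt' : e < c * m := (ENNReal.ofReal_lt_ofReal_iff_of_nonneg he0).1 hlt
  refine absurd hlt' (not_lt.2 ?_)
  let w : RN N → ℝ := fun y => max (u y - b) 0
  let A : Set (RN N) := {y | b < u y}
  let S : Set (RN N) := {y | a < u y ∧ u y ≤ b}
  let P : Set (RN N) := {y | 0 < u y ∧ u y < d}
  have hwint : Integrable w := by
    refine hi.mono ((hu.sub_const b).max measurable_const).aestronglyMeasurable
      (ae_of_all _ fun y => ?_)
    rw [Real.norm_of_nonneg (le_max_right _ _)]
    exact max_le ((sub_le_self _ hbp.le).trans (Real.le_norm_self _)) (norm_nonneg _)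
  have hAm : MeasurableSet A := measurableSet_lt measurable_const hu
  have hSm : MeasurableSet S :=
    (measurableSet_lt measurable_const hu).inter (measurableSet_le hu measurable_const)
  have hPm : MeasurableSet P :=
    (measurableSet_lt measurable_const hu).inter (measurableSet_lt hu measurable_const)
  have hAfin : volume A ≠ ⊤ := (hi.measure_gt_lt_top hbp).ne
  have hSfin : volume S ≠ ⊤ :=
    ((measure_mono fun y hy => hy.1).trans_lt (hi.measure_gt_lt_top hap)).ne
  have hP : (∫ y in P, |u y|) ≤ e / c' := by
    rw [le_div_iff₀ hc', ← ENNReal.ofReal_le_ofReal_iff he0, ← hE, mul_comm,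
      ENNReal.ofReal_mul hc'.le]
    have h1 := ofReal_integral_norm_eq_lintegral_enorm (hi.restrict (s := P))
    simp only [Real.norm_eq_abs] at h1
    rw [h1, ← lintegral_const_mul' _ _ ENNReal.ofReal_ne_top]
    refine (setLIntegral_mono' hPm fun y hy => ?_).trans (setLIntegral_le_lintegral P _)
    rw [← ofReal_norm, ← ENNReal.ofReal_mul hc'.le, Real.norm_of_nonneg hy.1.le]
    exact hfd _ hy.1 hy.2 _
  have hSP : (∫ y in S, |u y|) ≤ ∫ y in P, |u y| := by
    refine setIntegral_mono_set hi.abs.integrableOn (ae_of_all _ fun y => abs_nonneg _)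
      (LE.le.eventuallyLE fun y (hy : y ∈ S) => ⟨hap.trans hy.1, hy.2.trans_lt (by rw [hb]; linarith)⟩)
  have hJA : ∫ y in A, |u y| = (∫ y, w y) + b * volume.real A := by
    have h1 : ∫ y in A, w y = ∫ y, w y := setIntegral_eq_integral_of_forall_compl_eq_zero
      fun y hy => max_eq_right (by have : ¬ b < u y := hy; linarith)
    rw [← h1, setIntegral_congr_fun hAm (g := fun y => w y + b) fun y hy => ?_,
      integral_add hwint.restrict (integrableOn_const hAfin), setIntegral_const]
    · simp [mul_comm]
    · have hy' : b < u y := hy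
      simp only [w]
      rw [max_eq_left (by linarith), abs_of_pos (by linarith)]; ring
  have hrpow : volume A ^ (1 / N : ℝ) = ENNReal.ofReal (volume.real A ^ (1 / N : ℝ)) := by
    rw [← ENNReal.ofReal_rpow_of_nonneg measureReal_nonneg (by positivity),
      ofReal_measureReal hAfin]
  have hI0 : ∀ T : Set (RN N), 0 ≤ ∫ y in T, |u y| := fun T => integral_nonneg fun y => abs_nonneg _
  have hind : ∀ T : Set (RN N), MeasurableSet T → volume T ≠ ⊤ →
      ∫⁻ y, ‖T.indicator G y‖ₑ ≤
        ENNReal.ofReal (volume.real T + (e + β * ∫ y in T, |u y|) / α) := fun T hT hTf => by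
    simp only [enorm_indicator_eq_indicator_enorm]
    rw [lintegral_indicator hT]
    exact setLIntegral_enorm_grad_le_ofReal hα hβ hp hf x hu hi G he0 hE hTf
  refine hm e (volume.real A) (volume.real S) (∫ y, w y) he0 measureReal_nonneg measureReal_nonneg
    (integral_nonneg fun y => le_max_right _ _) ?_ ?_ ?_ ?_ ?_
  · exact hlt'.le.trans (by gcongr)
  · refine le_trans ?_ (hSP.trans hP)
    have := setIntegral_mono_on (integrableOn_const hSfin (C := a)) hi.abs.integrableOn hSm
      fun y hy => hy.1.le.trans (le_abs_self _)
    rw [setIntegral_const] at this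
    simpa [mul_comm] using this
  · have hint : Integrable fun y => min (max (u y - a) 0) (b - a) := by
      refine hi.mono (((hu.sub_const a).max measurable_const).min
        measurable_const).aestronglyMeasurable (ae_of_all _ fun y => ?_)
      rw [Real.norm_of_nonneg (le_min (le_max_right _ _) (by linarith))]
      exact (min_le_left _ _).trans
        (max_le ((sub_le_self _ hap.le).trans (Real.le_norm_self _)) (norm_nonneg _))
    -- The truncation equals `b - a` on `A`, while its gradient lives on the layer `S`, whose
    -- measure is already controlled.
    have h1 := hS _ _ A (h.truncate hab.le) hint
    have h2 : ∫⁻ y in A, ‖min (max (u y - a) 0) (b - a)‖ₑ =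
        ENNReal.ofReal ((b - a) * volume.real A) := by
      rw [setLIntegral_congr_fun hAm (g := fun _ => ENNReal.ofReal (b - a)) fun y hy => ?_,
        setLIntegral_const, ENNReal.ofReal_mul (by linarith), ofReal_measureReal hAfin]
      have hy' : b < u y := hy
      beta_reduce
      rw [max_eq_left (by linarith), min_eq_right (by linarith), ← ofReal_norm,
        Real.norm_of_nonneg (by linarith)]
    rw [h2, hrpow, ← ENNReal.ofReal_mul hC] at h1
    have h3 := h1.trans (mul_le_mul' le_rfl (hind S hSm hSfin))
    have hX : 0 ≤ volume.real S + (e + β * ∫ y in S, |u y|) / α := by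
      have := hI0 S; positivity
    rw [← ENNReal.ofReal_mul (by positivity), ENNReal.ofReal_le_ofReal_iff (by positivity)] at h3
    refine h3.trans ?_
    have := hSP.trans hP
    gcongr
  -- Here the gradient lives on `A` itself, where the integral of `|u|` is `J + b |A|`.
  · have h1 := hS _ _ A (h.posPart_sub b) hwint
    have h2 : ∫⁻ y in A, ‖max (u y - b) 0‖ₑ = ENNReal.ofReal (∫ y, w y) := by
      have h4 : ∫ y in A, ‖w y‖ = ∫ y, w y := by
        rw [setIntegral_eq_integral_of_forall_compl_eq_zero fun y hy => ?_]
        · exact integral_congr_ae (ae_of_all _ fun y => Real.norm_of_nonneg (le_max_right _ _))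
        · have : ¬ b < u y := hy
          simp only [w]
          rw [max_eq_right (by linarith), norm_zero]
      rw [← h4, ofReal_integral_norm_eq_lintegral_enorm hwint.restrict]
    rw [h2, hrpow, ← ENNReal.ofReal_mul hC] at h1
    have h3 := h1.trans (mul_le_mul' le_rfl (hind A hAm hAfin))
    have hX : 0 ≤ volume.real A + (e + β * ∫ y in A, |u y|) / α := by
      have := hI0 A; positivity
    rw [← ENNReal.ofReal_mul (by positivity), ENNReal.ofReal_le_ofReal_iff (by positivity),
      hJA] at h3
    exact h3
  · have h1 : ∫ y, u y ≤ ∫ y, P.indicator (fun y => |u y|) y + 2 * w y := by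
      refine integral_mono hi ((hi.abs.indicator hPm).add (hwint.const_mul 2)) fun y => ?_
      have hw0 : 0 ≤ w y := le_max_right _ _
      have hw1 : u y - b ≤ w y := le_max_left _ _
      by_cases hy : y ∈ P
      · simp only [indicator_of_mem hy]
        have := le_abs_self (u y); linarith
      · simp only [indicator_of_notMem hy]
        rcases le_or_gt (u y) 0 with h0 | h0
        · linarith
        · have : d ≤ u y := not_lt.1 fun h => hy ⟨h0, h⟩
          rw [hb] at hw1; linarith
    rw [integral_add (hi.abs.indicator hPm) (hwint.const_mul 2), integral_indicator hPm,
      integral_const_mul, hum] at h1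
    linarith

/-- The lower bound for the slope of the minimal cost at the origin. -/
theorem lowerSlope_le_liminf (hN : 1 ≤ N) {f : RN N → ℝ → RN N → ℝ≥0∞} (hf : HypCompact f)
    (x : RN N) : lowerSlope (Ioi 0) f x ≤
      liminf (fun m : ℝ => minimalCost f x m / ENNReal.ofReal |m|) (𝓝[>] 0) := by
  refine le_of_forall_lt fun c hc => ?_
  -- The pointwise bound holds with `c₂`, and passing to integrals lowers it to `c₁`. Both are
  -- finite even when the lower slope is infinite.
  obtain ⟨c₁, hc₁, hc₁'⟩ := exists_between hc
  obtain ⟨c₂, hc₂, hc₂'⟩ := exists_between hc₁'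
  have hc₁f : c₁ ≠ ⊤ := hc₂.ne_top
  have hc₂f : c₂ ≠ ⊤ := hc₂'.ne_top
  have h12 : c₁.toReal < c₂.toReal := (ENNReal.toReal_lt_toReal hc₁f hc₂f).2 hc₂
  have h2 : 0 < c₂.toReal := ENNReal.toReal_nonneg.trans_lt h12
  rw [← ENNReal.ofReal_toReal hc₂f] at hc₂'
  obtain ⟨d, hd, hfd⟩ := exists_le_of_lt_lowerSlope hf x h2 hc₂'
  refine hc₁.trans_le (le_liminf_of_le (by isBoundedDefault) ?_)
  filter_upwards [eventually_le_lintegral hN hf x h2 h12 hd hfd, self_mem_nhdsWithin] with m hm hmp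
  replace hmp : 0 < m := hmp
  rw [abs_of_pos hmp, ENNReal.le_div_iff_mul_le (Or.inl (by simpa using hmp))
    (Or.inl ENNReal.ofReal_ne_top), ← ENNReal.ofReal_toReal hc₁f,
    ← ENNReal.ofReal_mul ENNReal.toReal_nonneg]
  refine le_iInf₂ fun u hu => le_iInf₂ fun G hG => ?_
  obtain ⟨hi, hum⟩ := hu
  have hae := hi.1.ae_eq_mk
  have h3 := hm (hi.1.mk u) G hi.1.stronglyMeasurable_mk.measurable
    (hG.congr_ae hae (ae_eq_refl _)) (hi.congr hae) (by rw [← integral_congr_ae hae, hum])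
  refine h3.trans (le_of_eq (lintegral_congr_ae ?_))
  filter_upwards [hae] with y hy
  rw [hy]

end Lower

end MinimalCost

namespace MinimalCost

/-! ### Weak gradients in dimension one -/

section DimOne

theorem locallyIntegrable_comp_lineIso {F : Type*} [NormedAddCommGroup F] {k : RN 1 → F} :
    LocallyIntegrable (fun t => k (lineIso t)) ↔ LocallyIntegrable k := by
  have := locallyIntegrable_map_homeomorph (μ := volume) lineIso.toHomeomorph (f := k)
  rw [show Measure.map lineIso.toHomeomorph volume = volume from
    measurePreserving_lineIso.map_eq] at this
  exact this.symm

theorem _root_.MeasureTheory.LocallyIntegrable.intervalIntegrable' {g : ℝ → ℝ}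
    (hg : LocallyIntegrable g) (a b : ℝ) : IntervalIntegrable g volume a b :=
  (hg.integrableOn_isCompact isCompact_uIcc).intervalIntegrable

theorem lineIso_apply (t : ℝ) : lineIso t = t • lineIso 1 := by
  rw [← map_smul, smul_eq_mul, mul_one]

theorem inner_lineIso (s t : ℝ) : inner ℝ (lineIso s) (lineIso t) = s * t := by
  rw [lineIso.inner_map_map]; simp [mul_comm]

theorem lintegral_comp_lineIso (k : RN 1 → ℝ≥0∞) : ∫⁻ t, k (lineIso t) = ∫⁻ y, k y :=
  measurePreserving_lineIso.lintegral_comp_emb lineIso.toHomeomorph.measurableEmbedding k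

theorem integral_comp_lineIso {F : Type*} [NormedAddCommGroup F] [NormedSpace ℝ F]
    (k : RN 1 → F) : ∫ t, k (lineIso t) = ∫ y, k y :=
  measurePreserving_lineIso.integral_comp lineIso.toHomeomorph.measurableEmbedding k

/-- A primitive of a locally integrable function is weakly differentiable. -/
theorem hasWeakGradient_primitive {g : ℝ → ℝ} (hg : LocallyIntegrable g) (c t₀ : ℝ) :
    HasWeakGradient (fun y : RN 1 => c + ∫ s in t₀..(lineIso.symm y), g s)
      (fun y => lineIso (g (lineIso.symm y))) := by
  have hint : ∀ a b, IntervalIntegrable g volume a b := fun a b => hg.intervalIntegrable' a b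
  have hcont : Continuous fun t => c + ∫ s in t₀..t, g s :=
    continuous_const.add (intervalIntegral.continuous_primitive hint t₀)
  refine ⟨(hcont.comp lineIso.symm.continuous).locallyIntegrable, ?_, fun φ hφ hc v => ?_⟩
  · rw [← locallyIntegrable_comp_lineIso]
    simp only [LinearIsometryEquiv.symm_apply_apply]
    exact hg.mono (lineIso.continuous.comp_aestronglyMeasurable hg.aestronglyMeasurable)
      (ae_of_all _ fun t => (lineIso.norm_map _).le)
  · obtain ⟨v, rfl⟩ := lineIso.surjective v
    rw [← integral_comp_lineIso, ← integral_comp_lineIso]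
    simp only [LinearIsometryEquiv.symm_apply_apply, inner_lineIso]
    have hψ : ContDiff ℝ ∞ fun t => φ (lineIso t) := hφ.comp lineIso.contDiff
    have hψc : HasCompactSupport fun t => φ (lineIso t) :=
      hc.comp_homeomorph lineIso.toHomeomorph
    have hD : ∀ t, fderiv ℝ φ (lineIso t) (lineIso v) = deriv (fun t => φ (lineIso t)) t * v :=
      fun t => by
      have h1 : HasFDerivAt (fun t => φ (lineIso t)) _ t :=
        (hφ.differentiable (by simp) (lineIso t)).hasFDerivAt.comp t
          lineIso.toContinuousLinearEquiv.hasFDerivAt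
      rw [h1.hasDerivAt.deriv, lineIso_apply v, map_smul, smul_eq_mul, mul_comm]
      rfl
    obtain ⟨R, hR⟩ := hψc.isCompact.isBounded.subset_ball 0
    have hout : ∀ t, R ≤ |t| → φ (lineIso t) = 0 := fun t ht => by
      refine image_eq_zero_of_notMem_tsupport (f := fun t => φ (lineIso t)) fun h => ?_
      have := mem_ball_zero_iff.1 (hR h)
      rw [Real.norm_eq_abs] at this
      linarith
    have hout' : ∀ t, R ≤ |t| → deriv (fun t => φ (lineIso t)) t = 0 := fun t ht => by
      by_contra h0
      have := mem_ball_zero_iff.1 (hR (support_deriv_subset h0))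
      rw [Real.norm_eq_abs] at this
      linarith
    -- `[-S, S]` reaches the bound `R` for the support of the test function, so the boundary terms
    -- vanish, and contains `t₀`, so the primitive is absolutely continuous on it. The `1` keeps `S`
    -- positive.
    set S := max (max R 1) |t₀| with hS
    have hRS : R ≤ S := (le_max_left _ _).trans (le_max_left _ _)
    have hS0 : 0 < S := one_pos.trans_le ((le_max_right _ _).trans (le_max_left _ _))
    have ht₀ : t₀ ∈ uIcc (-S) S := by
      rw [uIcc_of_le (by linarith)]
      exact abs_le.1 (le_max_right _ _)
    have hac : AbsolutelyContinuousOnInterval (fun t => c + ∫ s in t₀..t, g s) (-S) S :=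
      (contDiffOn_const (c := c)).absolutelyContinuousOnInterval.add
        ((hint (-S) S).absolutelyContinuousOnInterval_intervalIntegral ht₀)
    have hac' : AbsolutelyContinuousOnInterval (fun t => φ (lineIso t)) (-S) S :=
      (hψ.of_le (by simp)).contDiffOn.absolutelyContinuousOnInterval
    have hibp := hac.integral_mul_deriv_eq_deriv_mul hac'
    rw [hout S (by rw [abs_of_pos hS0]; exact hRS),
      hout (-S) (by rw [abs_neg, abs_of_pos hS0]; exact hRS)] at hibp
    have hrestr : ∀ k : ℝ → ℝ, (∀ t, R ≤ |t| → k t = 0) → ∫ t in (-S)..S, k t = ∫ t, k t := by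
      intro k hk
      rw [intervalIntegral.integral_of_le (by linarith)]
      refine setIntegral_eq_integral_of_forall_compl_eq_zero fun t ht => hk t ?_
      by_contra hlt
      rw [not_le, abs_lt] at hlt
      exact ht ⟨by linarith, by linarith⟩
    have hder : ∫ t in (-S)..S, deriv (fun t => c + ∫ s in t₀..t, g s) t * φ (lineIso t) =
        ∫ t in (-S)..S, g t * φ (lineIso t) := by
      refine intervalIntegral.integral_congr_ae ?_
      filter_upwards [_root_.LocallyIntegrable.ae_hasDerivAt_integral hg] with t ht _
      rw [((ht t₀).const_add c).deriv]
    rw [hder, hrestr _ fun t ht => by rw [hout' t ht, mul_zero],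
      hrestr _ fun t ht => by rw [hout t ht, mul_zero]] at hibp
    simp only [hD, ← mul_assoc]
    rw [integral_mul_const, integral_mul_const, hibp]
    simp only [mul_comm (φ _)]
    ring

/-- A function whose weak gradient vanishes is constant. -/
theorem HasWeakGradient.ae_eq_const {N : ℕ} {d : RN N → ℝ} (h : HasWeakGradient d fun _ => 0) :
    ∃ c, ∀ᵐ y, d y = c := by
  -- Each mollification has zero classical gradient, hence is constant; these constants converge
  -- almost everywhere to `d`.
  have hconst : ∀ n y, mollify (bumpSeq N n) d y = mollify (bumpSeq N n) d 0 := fun n y => by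
    refine is_const_of_fderiv_eq_zero (𝕜 := ℝ)
      ((contDiff_mollify _ h.locallyIntegrable).differentiable (by simp)) (fun z => ?_) y 0
    ext v
    rw [h.fderiv_mollify, mollify_apply]
    simp
  have hae := ae_tendsto_mollify h.locallyIntegrable
  simp only [hconst] at hae
  obtain ⟨y₀, hy₀⟩ := hae.exists
  exact ⟨d y₀, hae.mono fun y hy => tendsto_nhds_unique hy hy₀⟩

/-- In dimension one a weakly differentiable function is the primitive of its derivative. -/
theorem HasWeakGradient.exists_ae_eq_primitive {w : RN 1 → ℝ} {G : RN 1 → RN 1}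
    (h : HasWeakGradient w G) :
    ∃ c, ∀ᵐ t, w (lineIso t) = c + ∫ s in (0 : ℝ)..t, lineIso.symm (G (lineIso s)) := by
  have hg : LocallyIntegrable fun s => lineIso.symm (G (lineIso s)) := by
    have := locallyIntegrable_comp_lineIso.2 h.locallyIntegrable_grad
    exact this.mono (lineIso.symm.continuous.comp_aestronglyMeasurable this.aestronglyMeasurable)
      (ae_of_all _ fun t => (lineIso.symm.norm_map _).le)
  have h1 := h.sub (hasWeakGradient_primitive hg 0 0)
  simp only [LinearIsometryEquiv.apply_symm_apply, sub_self] at h1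
  obtain ⟨c, hc⟩ := h1.ae_eq_const
  refine ⟨c, ?_⟩
  filter_upwards [measurePreserving_lineIso.quasiMeasurePreserving.ae hc] with t ht
  simp only [LinearIsometryEquiv.symm_apply_apply, zero_add] at ht
  linarith

/-- The function obtained from `k` by inserting at `t₀` an interval of length `L` on which it takes
the value `c`. -/
noncomputable def insertPlateau {X : Type*} (t₀ L : ℝ) (c : X) (k : ℝ → X) (t : ℝ) : X :=
  if t < t₀ then k t else if t < t₀ + L then c else k (t - L)

theorem insertPlateau_comp {X Y : Type*} (F : X → Y) (t₀ L : ℝ) (c : X) (k : ℝ → X) (t : ℝ) :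
    F (insertPlateau t₀ L c k t) = insertPlateau t₀ L (F c) (fun s => F (k s)) t := by
  unfold insertPlateau; split_ifs <;> rfl

theorem lintegral_insertPlateau {t₀ L : ℝ} (hL : 0 ≤ L) (c : ℝ≥0∞) (k : ℝ → ℝ≥0∞) :
    ∫⁻ t, insertPlateau t₀ L c k t = (∫⁻ t, k t) + c * ENNReal.ofReal L := by
  have h1 : ∫⁻ t in Iio t₀, insertPlateau t₀ L c k t = ∫⁻ t in Iio t₀, k t :=
    setLIntegral_congr_fun measurableSet_Iio fun t ht => if_pos ht
  have h2 : ∫⁻ t in Ici t₀ ∩ Iio (t₀ + L), insertPlateau t₀ L c k t = c * ENNReal.ofReal L := by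
    rw [setLIntegral_congr_fun (measurableSet_Ici.inter measurableSet_Iio) (g := fun _ => c)
      fun t ht => ?_, setLIntegral_const, Ici_inter_Iio, Real.volume_Ico, add_sub_cancel_left]
    have h3 : ¬ t < t₀ := not_lt.2 ht.1
    have h4 : t < t₀ + L := ht.2
    simp [insertPlateau, h3, h4]
  have h3 : ∫⁻ t in Ici t₀ \ Iio (t₀ + L), insertPlateau t₀ L c k t = ∫⁻ t in Ici t₀, k t := by
    have hset : Ici t₀ \ Iio (t₀ + L) = (fun t => t - L) ⁻¹' Ici t₀ := by
      ext t
      simp only [Set.mem_sdiff, mem_Ici, mem_Iio, not_lt, mem_preimage]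
      constructor
      · rintro ⟨-, h⟩; linarith
      · intro h; constructor <;> linarith
    have h5 := (measurePreserving_sub_right volume L).setLIntegral_comp_preimage_emb
      (MeasurableEquiv.subRight L).measurableEmbedding k (Ici t₀)
    rw [hset, ← h5]
    refine setLIntegral_congr_fun (measurable_id.sub_const L measurableSet_Ici) fun t ht => ?_
    have h4 : t₀ ≤ t - L := ht
    simp [insertPlateau, show ¬ t < t₀ by linarith, show ¬ t < t₀ + L by linarith]
  rw [← lintegral_add_compl _ (measurableSet_Iio (a := t₀)), compl_Iio, h1,
    ← lintegral_inter_add_sdiff (μ := volume) _ (Ici t₀) (measurableSet_Iio (a := t₀ + L)), h2, h3,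
    ← lintegral_add_compl (μ := volume) (fun t => k t) (measurableSet_Iio (a := t₀)), compl_Iio]
  ring

theorem insertPlateau_ae_congr {X : Type*} {t₀ L : ℝ} {c : X} {k k' : ℝ → X}
    (h : ∀ᵐ t, k t = k' t) :
    ∀ᵐ t, insertPlateau t₀ L c k t = insertPlateau t₀ L c k' t := by
  filter_upwards [h, (measurePreserving_sub_right volume L).quasiMeasurePreserving.ae h]
    with t h1 h2
  unfold insertPlateau
  rw [h1, h2]

theorem locallyIntegrable_insertPlateau {t₀ L : ℝ} {k : ℝ → ℝ} (hk : LocallyIntegrable k) :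
    LocallyIntegrable (insertPlateau t₀ L 0 k) := by
  have hk' : LocallyIntegrable fun t => k (t - L) := by
    have := locallyIntegrable_map_homeomorph (μ := volume) (Homeomorph.subRight L) (f := k)
    rw [show Measure.map (Homeomorph.subRight L) volume = volume from
      (measurePreserving_sub_right volume L).map_eq] at this
    exact this.1 hk
  refine (hk.norm_real.add hk'.norm_real).mono ?_ (ae_of_all _ fun t => ?_)
  · have heq : insertPlateau t₀ L 0 k =
        (Iio t₀).piecewise k ((Iio (t₀ + L)).piecewise 0 fun t => k (t - L)) := by
      ext t; simp [insertPlateau, Set.piecewise]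
    rw [heq]
    exact AEStronglyMeasurable.piecewise measurableSet_Iio hk.aestronglyMeasurable.restrict
      (AEStronglyMeasurable.piecewise measurableSet_Iio aestronglyMeasurable_const
        hk'.aestronglyMeasurable.restrict).restrict
  · change _ ≤ ‖‖k t‖ + ‖k (t - L)‖‖
    rw [Real.norm_of_nonneg (add_nonneg (norm_nonneg (k t)) (norm_nonneg (k (t - L))))]
    have h1 := norm_nonneg (k t)
    have h2 := norm_nonneg (k (t - L))
    unfold insertPlateau
    split_ifs
    · linarith
    · rw [norm_zero]; linarith
    · linarith

/-- Inserting an interval of zero derivative delays the primitive by `L`. The pieces match because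
`h` is the value of the original primitive at `t₀`. -/
theorem primitive_insertPlateau {g : ℝ → ℝ} (hg : LocallyIntegrable g) {c h t₀ L : ℝ} (hL : 0 ≤ L)
    (hc : c + ∫ s in (0 : ℝ)..t₀, g s = h) (t : ℝ) :
    h + ∫ s in t₀..t, insertPlateau t₀ L 0 g s =
      insertPlateau t₀ L h (fun t => c + ∫ s in (0 : ℝ)..t, g s) t := by
  have hint : ∀ a b, IntervalIntegrable g volume a b := fun a b => hg.intervalIntegrable' a b
  have hint' : ∀ a b, IntervalIntegrable (insertPlateau t₀ L 0 g) volume a b := fun a b =>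
    (locallyIntegrable_insertPlateau hg).intervalIntegrable' a b
  have hmid : ∀ t, t₀ ≤ t → t ≤ t₀ + L → ∫ s in t₀..t, insertPlateau t₀ L 0 g s = 0 := by
    intro t h1 h2
    rw [intervalIntegral.integral_of_le h1, integral_Ioc_eq_integral_Ioo]
    refine setIntegral_eq_zero_of_forall_eq_zero fun s hs => ?_
    simp [insertPlateau, show ¬ s < t₀ from not_lt.2 hs.1.le, show s < t₀ + L from hs.2.trans_le h2]
  rw [insertPlateau]
  split_ifs with h1 h2
  · rw [intervalIntegral.integral_symm, intervalIntegral.integral_of_le h1.le,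
      integral_Ioc_eq_integral_Ioo, setIntegral_congr_fun (f := insertPlateau t₀ L 0 g) (g := g)
      measurableSet_Ioo fun s hs => if_pos hs.2, ← integral_Ioc_eq_integral_Ioo, ← hc,
      ← intervalIntegral.integral_of_le h1.le,
      ← intervalIntegral.integral_add_adjacent_intervals (hint 0 t) (hint t t₀)]
    ring
  · rw [hmid t (not_lt.1 h1) h2.le, add_zero]
  · have h2' := not_lt.1 h2
    rw [← intervalIntegral.integral_add_adjacent_intervals (hint' t₀ (t₀ + L)) (hint' (t₀ + L) t),
      hmid _ (by linarith) le_rfl, zero_add, ← hc,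
      ← intervalIntegral.integral_add_adjacent_intervals (hint 0 t₀) (hint t₀ (t - L)), add_assoc]
    congr 2
    have h3 : ∫ s in (t₀ + L)..t, insertPlateau t₀ L 0 g s = ∫ s in (t₀ + L)..t, g (s - L) := by
      refine intervalIntegral.integral_congr fun s hs => ?_
      rw [uIcc_of_le h2'] at hs
      simp [insertPlateau, show ¬ s < t₀ by linarith [hs.1], show ¬ s < t₀ + L by linarith [hs.1]]
    rw [h3, intervalIntegral.integral_comp_sub_right, add_sub_cancel_right]

/-- Inserting a plateau of height `h` at a point where a weakly differentiable function takes
the value `h`. -/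
theorem HasWeakGradient.exists_insertPlateau {w : RN 1 → ℝ} {G : RN 1 → RN 1}
    (hw : HasWeakGradient w G) {h L : ℝ} (hL : 0 ≤ L) (hpos : 0 < volume {y | w y = h}) :
    ∃ t₀, HasWeakGradient
      (fun y => insertPlateau t₀ L h (fun t => w (lineIso t)) (lineIso.symm y))
      (fun y => insertPlateau t₀ L 0 (fun t => G (lineIso t)) (lineIso.symm y)) := by
  obtain ⟨c, hc⟩ := hw.exists_ae_eq_primitive
  set g := fun s => lineIso.symm (G (lineIso s)) with hgdef
  have hg : LocallyIntegrable g := by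
    have := locallyIntegrable_comp_lineIso.2 hw.locallyIntegrable_grad
    exact this.mono (lineIso.symm.continuous.comp_aestronglyMeasurable this.aestronglyMeasurable)
      (ae_of_all _ fun t => (lineIso.symm.norm_map _).le)
  -- Positive measure ensures that the level set meets the full-measure set where `w` agrees with
  -- its continuous representative.
  have hpos' : ∃ᵐ t, w (lineIso t) = h := by
    rw [frequently_ae_iff]
    have := measurePreserving_lineIso.measure_preimage_emb
      lineIso.toHomeomorph.measurableEmbedding {y | w y = h}
    exact (this ▸ hpos).ne'
  obtain ⟨t₀, h1, h2⟩ := (hpos'.and_eventually hc).exists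
  refine ⟨t₀, (hasWeakGradient_primitive (locallyIntegrable_insertPlateau hg (t₀ := t₀) (L := L))
    h t₀).congr_ae ?_ (ae_of_all _ fun y => ?_)⟩
  · have h3 := insertPlateau_ae_congr (t₀ := t₀) (L := L) (c := h) hc
    have hmp : MeasurePreserving lineIso.symm := lineIso.symm.measurePreserving
    filter_upwards [hmp.quasiMeasurePreserving.ae h3] with y hy
    rw [hy, primitive_insertPlateau hg hL (h2 ▸ h1)]
  · beta_reduce
    rw [insertPlateau_comp (fun s => lineIso s)]
    simp [hgdef]

end DimOne

end MinimalCost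

namespace MinimalCost

/-! ### Upper bound -/

section Upper

variable {N : ℕ} {f : RN N → ℝ → RN N → ℝ≥0∞}

/-- Otherwise lower semicontinuity keeps `f` above a positive constant near `(x, 0, 0)`, and
division by `|u| → 0` makes the lower slope infinite. Hence competitors pay nothing where they
vanish with zero gradient. -/
theorem HypLsc.apply_zero_eq_zero (hf : HypLsc f) {x : RN N} (hx : lowerSlope (Ioi 0) f x ≠ ⊤) :
    f x 0 0 = 0 := by
  by_contra h0
  obtain ⟨y, hy0, hy⟩ := exists_between (pos_iff_ne_zero.2 h0)
  refine hx ?_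
  have hle : 𝓝 x ×ˢ 𝓝[>] (0 : ℝ) ×ˢ 𝓝 (0 : RN N) ≤ 𝓝 (x, (0 : ℝ), (0 : RN N)) := by
    rw [nhds_prod_eq, nhds_prod_eq]
    exact prod_mono le_rfl (prod_mono nhdsWithin_le_nhds le_rfl)
  have h1 : ∀ᶠ z in 𝓝 x ×ˢ 𝓝[>] (0 : ℝ) ×ˢ 𝓝 (0 : RN N), y < f z.1 z.2.1 z.2.2 :=
    hle (hf (x, 0, 0) y hy)
  have h2 : Tendsto (fun z : RN N × ℝ × RN N => y / ENNReal.ofReal |z.2.1|)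
      (𝓝 x ×ˢ 𝓝[>] (0 : ℝ) ×ˢ 𝓝 (0 : RN N)) (𝓝 ⊤) := by
    have h3 : Tendsto (fun z : RN N × ℝ × RN N => ENNReal.ofReal |z.2.1|)
        (𝓝 (x, (0 : ℝ), (0 : RN N))) (𝓝 0) := by
      have : Continuous fun z : RN N × ℝ × RN N => ENNReal.ofReal |z.2.1| :=
        ENNReal.continuous_ofReal.comp (by fun_prop)
      simpa using this.tendsto (x, (0 : ℝ), (0 : RN N))
    have h4 := ENNReal.Tendsto.const_div (a := y) (h3.mono_left hle) (Or.inr hy.ne_top)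
    rwa [ENNReal.div_zero hy0.ne'] at h4
  rw [lowerSlope, ← top_le_iff, ← h2.liminf_eq]
  refine liminf_le_liminf ?_
  filter_upwards [h1] with z hz
  gcongr

theorem HypLsc.aemeasurable_comp (hf : HypLsc f) (x : RN N) {u : RN N → ℝ} {G : RN N → RN N}
    (hu : AEMeasurable u) (hG : AEMeasurable G) : AEMeasurable fun y => f x (u y) (G y) :=
  (LowerSemicontinuous.measurable hf).comp_aemeasurable
    (aemeasurable_const.prodMk (hu.prodMk hG))

/-- To bound `minimalCost` it suffices to exhibit a nonnegative competitor. -/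
theorem minimalCost_le_of_nonneg {x : RN N} {m : ℝ} (hm : 0 ≤ m) {u : RN N → ℝ} {G : RN N → RN N}
    (h : HasWeakGradient u G) (hu : ∀ y, 0 ≤ u y)
    (hum : ∫⁻ y, ENNReal.ofReal (u y) = ENNReal.ofReal m) :
    minimalCost f x m ≤ ∫⁻ y, f x (u y) (G y) := by
  have hmeas := h.locallyIntegrable.aestronglyMeasurable
  refine iInf₂_le_of_le u ⟨⟨hmeas, ?_⟩, ?_⟩ (iInf₂_le G h)
  · rw [hasFiniteIntegral_iff_ofReal (ae_of_all _ hu), hum]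
    exact ENNReal.ofReal_lt_top
  · rw [integral_eq_lintegral_of_nonneg_ae (ae_of_all _ hu) hmeas, hum, ENNReal.toReal_ofReal hm]

/-- A general `F` serves twice: for the mass, and for the energy as a function of the pair of value
and gradient. -/
theorem lintegral_insertPlateau_lineIso {X : Type*} {t₀ L : ℝ} (hL : 0 ≤ L) (F : X → ℝ≥0∞) (c : X)
    (k : RN 1 → X) :
    ∫⁻ y, F (insertPlateau t₀ L c (fun t => k (lineIso t)) (lineIso.symm y)) =
      (∫⁻ y, F (k y)) + F c * ENNReal.ofReal L := by
  rw [← lintegral_comp_lineIso, ← lintegral_comp_lineIso (fun y => F (k y)),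
    ← lintegral_insertPlateau (t₀ := t₀) hL]
  refine lintegral_congr fun t => ?_
  rw [LinearIsometryEquiv.symm_apply_apply, insertPlateau_comp F]

theorem insertPlateau_prod {X Y : Type*} (t₀ L : ℝ) (c : X) (c' : Y) (k : ℝ → X) (k' : ℝ → Y)
    (t : ℝ) : insertPlateau t₀ L (c, c') (fun s => (k s, k' s)) t =
      (insertPlateau t₀ L c k t, insertPlateau t₀ L c' k' t) := by
  unfold insertPlateau; split_ifs <;> rfl

/-- The upper bound for the minimal cost in dimension one. -/
theorem minimalCost_le_of_dim_one {f : RN 1 → ℝ → RN 1 → ℝ≥0∞} (hf : HypLsc f) {x : RN 1}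
    (hslope : upperSlope (Ioi 0) f 0 x ≤ lowerSlope (Ioi 0) f x)
    (hx : lowerSlope (Ioi 0) f x ≠ ⊤) {m₀ : ℝ} (hm₀ : 0 < m₀) (hfin : minimalCost f x m₀ ≠ ⊤)
    {m : ℝ} (hm : 0 < m) :
    minimalCost f x m ≤ lowerSlope (Ioi 0) f x * ENNReal.ofReal m := by
  set c := lowerSlope (Ioi 0) f x with hc
  have hf0 : f x 0 0 = 0 := hf.apply_zero_eq_zero hx
  suffices hε : ∀ ε : ℝ≥0∞, 0 < ε → ε ≠ ⊤ → minimalCost f x m ≤ ε + (c + ε) * ENNReal.ofReal m by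
    have hlim : Tendsto (fun ε : ℝ≥0∞ => ε + (c + ε) * ENNReal.ofReal m) (𝓝[>] 0)
        (𝓝 (0 + (c + 0) * ENNReal.ofReal m)) := by
      refine Tendsto.mono_left ?_ nhdsWithin_le_nhds
      exact tendsto_id.add (ENNReal.Tendsto.mul_const (tendsto_const_nhds.add tendsto_id)
        (Or.inr ENNReal.ofReal_ne_top))
    rw [zero_add, add_zero] at hlim
    refine ge_of_tendsto hlim ?_
    filter_upwards [self_mem_nhdsWithin, nhdsWithin_le_nhds (gt_mem_nhds ENNReal.zero_lt_top)]
      with ε h1 h2 using hε ε h1 h2.ne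
  intro ε hε hεtop
  have hplat : ∀ᶠ h in 𝓝[>] (0 : ℝ), f x h 0 ≤ (c + ε) * ENNReal.ofReal h := by
    have h1 : upperSlope (Ioi 0) f 0 x < c + ε :=
      hslope.trans_lt (ENNReal.lt_add_right hx hε.ne')
    filter_upwards [eventually_lt_of_limsup_lt h1, self_mem_nhdsWithin] with h h2 h3
    replace h3 : 0 < h := h3
    have h4 : f x h 0 / ENNReal.ofReal h ≤ c + ε := by
      refine le_trans ?_ h2.le
      -- Any unit vector would do, since `ρ = 0` erases it.
      refine le_iSup₂_of_le (lineIso 1) (by simp) ?_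
      simp [abs_of_pos h3]
    exact (ENNReal.div_le_iff (by simpa using h3) ENNReal.ofReal_ne_top).1 h4
  obtain ⟨u, ⟨hu, hum⟩, hE⟩ : ∃ u : RN 1 → ℝ, (Integrable u ∧ ∫ y, u y = m₀) ∧
      energy f x u < ⊤ := by
    have := lt_top_iff_ne_top.2 hfin
    simp only [minimalCost, iInf_lt_iff] at this
    obtain ⟨u, h1, h2⟩ := this
    exact ⟨u, h1, h2⟩
  replace ⟨G, hG, hE⟩ : ∃ G, HasWeakGradient u G ∧ ∫⁻ y, f x (u y) (G y) < ⊤ := by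
    simp only [energy, iInf_lt_iff] at hE
    obtain ⟨G, h1, h2⟩ := hE
    exact ⟨G, h1, h2⟩
  wlog hmu : Measurable u generalizing u
  · have hae := hu.1.ae_eq_mk
    refine this (hu.1.mk u) (hu.congr hae) ((integral_congr_ae hae).symm.trans hum)
      (hG.congr_ae hae (ae_eq_refl _)) ?_ hu.1.stronglyMeasurable_mk.measurable
    refine lt_of_eq_of_lt (lintegral_congr_ae ?_) hE
    filter_upwards [hae] with y hy
    rw [hy]
  -- A positive integral forces `u` to exceed small levels on a set of positive measure; after
  -- truncation the value `h` is attained there, which allows a plateau to be inserted.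
  have hpos : ∀ᶠ h in 𝓝[>] (0 : ℝ), 0 < volume {y | h < u y} := by
    have h1 : ∃ n : ℕ, 0 < volume {y | 1 / ((n : ℝ) + 1) < u y} := by
      by_contra! hcon
      have h2 : volume (⋃ n : ℕ, {y | 1 / ((n : ℝ) + 1) < u y}) = 0 :=
        measure_iUnion_null fun n => le_zero_iff.1 (hcon n)
      have h3 : ∀ᵐ y, u y ≤ 0 := by
        filter_upwards [measure_eq_zero_iff_ae_notMem.1 h2] with y hy
        by_contra! h4
        obtain ⟨n, hn⟩ := exists_nat_one_div_lt h4
        exact hy (mem_iUnion.2 ⟨n, hn⟩)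
      have := integral_nonpos_of_ae h3
      linarith
    obtain ⟨n, hn⟩ := h1
    filter_upwards [Ioo_mem_nhdsGT (show (0 : ℝ) < 1 / ((n : ℝ) + 1) by positivity)] with h hh
    exact hn.trans_le (measure_mono fun y (hy : _ < u y) => hh.2.trans hy)
  have hmG : AEMeasurable G := hG.locallyIntegrable_grad.aestronglyMeasurable.aemeasurable
  -- The sets `{0 < u ≤ h}` shrink to the empty set, so the energy carried by the transition layer
  -- vanishes.
  have hT : Tendsto (fun h : ℝ => ∫⁻ y, {y | 0 < u y ∧ u y ≤ h}.indicator
      (fun y => f x (u y) (G y)) y) (𝓝[>] 0) (𝓝 0) := by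
    rw [← lintegral_zero (μ := (volume : Measure (RN 1)))]
    refine tendsto_lintegral_filter_of_dominated_convergence' (fun y => f x (u y) (G y))
      (Eventually.of_forall fun h => (hf.aemeasurable_comp x hmu.aemeasurable hmG).indicator
        ((measurableSet_lt measurable_const hmu).inter (measurableSet_le hmu measurable_const)))
      (Eventually.of_forall fun h => ae_of_all _ fun y => indicator_le_self _ _ _) hE.ne
      (ae_of_all _ fun y => tendsto_const_nhds.congr' ?_)
    rcases le_or_gt (u y) 0 with h0 | h0
    · exact Eventually.of_forall fun h => (indicator_of_notMem (fun hh => hh.1.not_ge h0) _).symm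
    · filter_upwards [Ioo_mem_nhdsGT h0] with h hh
      exact (indicator_of_notMem (fun hy => hy.2.not_gt hh.2) _).symm
  have hM : Tendsto (fun h : ℝ => ∫⁻ y, ENNReal.ofReal (min (max (u y - 0) 0) (h - 0))) (𝓝[>] 0)
      (𝓝 0) := by
    rw [← lintegral_zero (μ := (volume : Measure (RN 1)))]
    refine tendsto_lintegral_filter_of_dominated_convergence (fun y => ‖u y‖ₑ)
      (Eventually.of_forall fun h => (((hmu.sub_const 0).max measurable_const).min
        measurable_const).ennreal_ofReal)
      (Eventually.of_forall fun h => ae_of_all _ fun y => ?_) hu.2.ne (ae_of_all _ fun y => ?_)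
    · rw [← ofReal_norm]
      refine ENNReal.ofReal_le_ofReal ((min_le_left _ _).trans (max_le ?_ (norm_nonneg _)))
      rw [sub_zero]; exact Real.le_norm_self _
    · have : Continuous fun h : ℝ => ENNReal.ofReal (min (max (u y - 0) 0) (h - 0)) :=
        ENNReal.continuous_ofReal.comp (by fun_prop)
      have h1 := (this.tendsto 0).mono_left (nhdsWithin_le_nhds (s := Ioi 0))
      simpa using h1
  obtain ⟨h, hplat, hpos, hT, hM, hh⟩ := (hplat.and (hpos.and ((hT.eventually_lt_const hε).and
    ((hM.eventually_lt_const (ENNReal.ofReal_pos.2 hm)).and self_mem_nhdsWithin)))).exists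
  replace hh : 0 < h := hh
  set w : RN 1 → ℝ := fun y => min (max (u y - 0) 0) (h - 0) with hw
  have hw0 : ∀ y, 0 ≤ w y := fun y => le_min (le_max_right _ _) (by linarith)
  have hgrad := hG.truncate hh.le
  set M := (∫⁻ y, ENNReal.ofReal (w y)).toReal with hMdef
  have hMe : ∫⁻ y, ENNReal.ofReal (w y) = ENNReal.ofReal M :=
    (ENNReal.ofReal_toReal hM.ne_top).symm
  have hMm : M < m := by
    rwa [hMe, ENNReal.ofReal_lt_ofReal_iff hm] at hM
  -- The length for which a plateau of height `h` supplies exactly the mass missing after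
  -- truncation.
  set L := (m - M) / h with hLdef
  have hL : 0 ≤ L := div_nonneg (by linarith) hh.le
  have hML : ENNReal.ofReal M + ENNReal.ofReal h * ENNReal.ofReal L = ENNReal.ofReal m := by
    rw [← ENNReal.ofReal_mul hh.le, ← ENNReal.ofReal_add ENNReal.toReal_nonneg (by positivity)]
    congr 1
    rw [hLdef]; field_simp; ring
  have hwh : 0 < volume {y | w y = h} := by
    refine hpos.trans_le (measure_mono fun y (hy : h < u y) => ?_)
    change min (max (u y - 0) 0) (h - 0) = h
    rw [sub_zero, sub_zero, max_eq_left (by linarith), min_eq_right hy.le]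
  obtain ⟨t₀, ht₀⟩ := hgrad.exists_insertPlateau hL hwh
  have hmw : Measurable w := ((hmu.sub_const 0).max measurable_const).min measurable_const
  refine (minimalCost_le_of_nonneg hm.le ht₀ (fun y => ?_) ?_).trans ?_
  · unfold insertPlateau
    split_ifs
    exacts [hw0 _, hh.le, hw0 _]
  · rw [lintegral_insertPlateau_lineIso hL ENNReal.ofReal h w, hMe, hML]
  · have h1 := lintegral_insertPlateau_lineIso (t₀ := t₀) hL
      (fun q : ℝ × RN 1 => f x q.1 q.2) (h, 0)
      (fun y => (w y, {y | 0 < u y ∧ u y ≤ h}.indicator G y))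
    simp only [insertPlateau_prod] at h1
    rw [h1]
    -- Three regions: the transition layer costs less than `ε` in all, `{u > h}` carries the
    -- constant state `h` with zero gradient, and `{u ≤ 0}` is free.
    have h2 : ∫⁻ y, f x (w y) ({y | 0 < u y ∧ u y ≤ h}.indicator G y) ≤
        ε + (c + ε) * ENNReal.ofReal M := by
      calc _ ≤ ∫⁻ y, {y | 0 < u y ∧ u y ≤ h}.indicator (fun y => f x (u y) (G y)) y +
            (c + ε) * ENNReal.ofReal (w y) := by
            refine lintegral_mono fun y => ?_
            by_cases hy : 0 < u y ∧ u y ≤ h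
            · have hwy : w y = u y := by
                change min (max (u y - 0) 0) (h - 0) = u y
                rw [sub_zero, sub_zero, max_eq_left hy.1.le, min_eq_left hy.2]
              have hmem : y ∈ {y | 0 < u y ∧ u y ≤ h} := hy
              rw [indicator_of_mem hmem, indicator_of_mem hmem, hwy]
              exact le_self_add
            · have hmem : y ∉ {y | 0 < u y ∧ u y ≤ h} := hy
              rw [indicator_of_notMem hmem, indicator_of_notMem hmem, zero_add]
              rcases le_or_gt (u y) 0 with h0 | h0
              · have hwy : w y = 0 := by
                  change min (max (u y - 0) 0) (h - 0) = 0
                  rw [sub_zero, sub_zero, max_eq_right h0, min_eq_left hh.le]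
                rw [hwy, hf0]; exact zero_le
              · have hhu : h < u y := not_le.1 fun hle => hy ⟨h0, hle⟩
                have hwy : w y = h := by
                  change min (max (u y - 0) 0) (h - 0) = h
                  rw [sub_zero, sub_zero, max_eq_left h0.le, min_eq_right hhu.le]
                rw [hwy]; exact hplat
        _ = (∫⁻ y, {y | 0 < u y ∧ u y ≤ h}.indicator (fun y => f x (u y) (G y)) y) +
            (c + ε) * ENNReal.ofReal M := by
            rw [lintegral_add_right _ (hmw.ennreal_ofReal.const_mul _),
              lintegral_const_mul' _ _ (by finiteness), hMe]
        _ ≤ _ := by gcongr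
    calc _ ≤ (ε + (c + ε) * ENNReal.ofReal M) + (c + ε) * ENNReal.ofReal h * ENNReal.ofReal L :=
          add_le_add h2 (mul_le_mul' hplat le_rfl)
      _ = ε + (c + ε) * (ENNReal.ofReal M + ENNReal.ofReal h * ENNReal.ofReal L) := by ring
      _ = _ := by rw [hML]

end Upper

end MinimalCost

namespace MinimalCost

/-! ### The radial profile -/

section Profile

variable {N : ℕ} {ρ : ℝ → ℝ}

/-- The time `∫_y^1 dt / ρ(t)` that the solution of `v' = -ρ(v)`, `v(0) = 1` takes to reach `y`. -/
noncomputable def hittingTime (ρ : ℝ → ℝ) (y : ℝ) : ℝ := ∫ t in y..1, (ρ t)⁻¹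

open Classical in
/-- The solution of `v' = -ρ(v)`, `v(0) = 1`, continued by `0`. -/
noncomputable def profile (ρ : ℝ → ℝ) (r : ℝ) : ℝ :=
  if h : ∃ t ∈ Ioc (0 : ℝ) 1, hittingTime ρ t = r then h.choose else 0

namespace IsAdmissibleProfile

theorem continuousOn_inv (h : IsAdmissibleProfile N ρ) :
    ContinuousOn (fun t => (ρ t)⁻¹) (Ioc 0 1) :=
  h.continuousOn.inv₀ fun t ht => (h.pos t ht).ne'

theorem uIcc_subset {s t : ℝ} (hs : s ∈ Ioc (0 : ℝ) 1) (ht : t ∈ Ioc (0 : ℝ) 1) :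
    uIcc s t ⊆ Ioc 0 1 :=
  ordConnected_Ioc.uIcc_subset hs ht

theorem intervalIntegrable_inv (h : IsAdmissibleProfile N ρ) {s t : ℝ} (hs : s ∈ Ioc (0 : ℝ) 1)
    (ht : t ∈ Ioc (0 : ℝ) 1) : IntervalIntegrable (fun t => (ρ t)⁻¹) volume s t :=
  (h.continuousOn_inv.mono (uIcc_subset hs ht)).intervalIntegrable

theorem one_mem : (1 : ℝ) ∈ Ioc (0 : ℝ) 1 := ⟨one_pos, le_rfl⟩

theorem hittingTime_sub (h : IsAdmissibleProfile N ρ) {s t : ℝ} (hs : s ∈ Ioc (0 : ℝ) 1)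
    (ht : t ∈ Ioc (0 : ℝ) 1) : hittingTime ρ s - hittingTime ρ t = ∫ τ in s..t, (ρ τ)⁻¹ := by
  rw [hittingTime, hittingTime, ← intervalIntegral.integral_add_adjacent_intervals
    (h.intervalIntegrable_inv hs ht) (h.intervalIntegrable_inv ht one_mem), add_sub_cancel_right]

theorem hittingTime_one : hittingTime ρ 1 = 0 := intervalIntegral.integral_same

theorem strictAntiOn_hittingTime (h : IsAdmissibleProfile N ρ) :
    StrictAntiOn (hittingTime ρ) (Ioc 0 1) := by
  intro s hs t ht hst
  rw [← sub_pos, h.hittingTime_sub hs ht]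
  refine intervalIntegral.intervalIntegral_pos_of_pos_on (h.intervalIntegrable_inv hs ht)
    (fun τ hτ => inv_pos.2 (h.pos τ ⟨hs.1.trans hτ.1, hτ.2.le.trans ht.2⟩)) hst

theorem hittingTime_nonneg (h : IsAdmissibleProfile N ρ) {t : ℝ} (ht : t ∈ Ioc (0 : ℝ) 1) :
    0 ≤ hittingTime ρ t := by
  have := h.strictAntiOn_hittingTime.antitoneOn ht one_mem ht.2
  rwa [hittingTime_one] at this

/-- A speed of at most `C` needs time at least `(t - s) / C`; read on the inverse function this is a
Lipschitz estimate for the profile. -/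
theorem div_le_hittingTime_sub (h : IsAdmissibleProfile N ρ) {C s t : ℝ} (hs : s ∈ Ioc (0 : ℝ) 1)
    (ht : t ∈ Ioc (0 : ℝ) 1) (hst : s ≤ t) (hC : ∀ τ ∈ Icc s 1, ρ τ ≤ C) :
    (t - s) / C ≤ hittingTime ρ s - hittingTime ρ t := by
  rw [h.hittingTime_sub hs ht]
  have h1 : ∫ _ in s..t, C⁻¹ = (t - s) / C := by simp [div_eq_mul_inv]
  rw [← h1]
  refine intervalIntegral.integral_mono_on hst intervalIntegrable_const
    (h.intervalIntegrable_inv hs ht) fun τ hτ => ?_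
  exact inv_anti₀ (h.pos τ ⟨hs.1.trans_le hτ.1, hτ.2.trans ht.2⟩) (hC τ ⟨hτ.1, hτ.2.trans ht.2⟩)

theorem hasDerivAt_hittingTime (h : IsAdmissibleProfile N ρ) {t : ℝ} (ht : t ∈ Ioo (0 : ℝ) 1) :
    HasDerivAt (hittingTime ρ) (-(ρ t)⁻¹) t := by
  have hc : ContinuousOn (fun t => (ρ t)⁻¹) (Ioo 0 1) := h.continuousOn_inv.mono Ioo_subset_Ioc_self
  exact intervalIntegral.integral_hasDerivAt_left
    (h.intervalIntegrable_inv (Ioo_subset_Ioc_self ht) one_mem)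
    (hc.stronglyMeasurableAtFilter isOpen_Ioo t ht) (hc.continuousAt (isOpen_Ioo.mem_nhds ht))

theorem exists_hittingTime_eq (h : IsAdmissibleProfile N ρ) {t r : ℝ} (ht : t ∈ Ioc (0 : ℝ) 1)
    (hr : 0 ≤ r) (hrt : r ≤ hittingTime ρ t) : ∃ s ∈ Ioc (0 : ℝ) 1, hittingTime ρ s = r := by
  have hc : ContinuousOn (hittingTime ρ) (Icc t 1) := by
    have := intervalIntegral.continuousOn_primitive_interval_left (μ := volume)
      (f := fun t => (ρ t)⁻¹) (a := t) (b := 1)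
      ((h.continuousOn_inv.mono (uIcc_subset ht one_mem)).integrableOn_compact isCompact_uIcc)
    rwa [uIcc_of_le ht.2] at this
  obtain ⟨s, hs, hsr⟩ := intermediate_value_Icc' ht.2 hc ⟨by rwa [hittingTime_one], hrt⟩
  exact ⟨s, ⟨ht.1.trans_le hs.1, hs.2⟩, hsr⟩

theorem profile_hittingTime (h : IsAdmissibleProfile N ρ) {t : ℝ} (ht : t ∈ Ioc (0 : ℝ) 1) :
    profile ρ (hittingTime ρ t) = t := by
  have hex : ∃ s ∈ Ioc (0 : ℝ) 1, hittingTime ρ s = hittingTime ρ t := ⟨t, ht, rfl⟩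
  rw [profile, dif_pos hex]
  exact h.strictAntiOn_hittingTime.injOn hex.choose_spec.1 ht hex.choose_spec.2

theorem profile_mem (ρ : ℝ → ℝ) (r : ℝ) : profile ρ r ∈ Icc (0 : ℝ) 1 := by
  unfold profile
  split_ifs with h
  · exact Ioc_subset_Icc_self h.choose_spec.1
  · simp

theorem hittingTime_profile {r : ℝ} (hr : 0 < profile ρ r) :
    hittingTime ρ (profile ρ r) = r := by
  unfold profile at hr ⊢
  split_ifs at hr ⊢ with h
  · exact h.choose_spec.2
  · exact absurd hr (lt_irrefl _)

/-- The profile inverts a strictly decreasing function. In this form the inversion also covers times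
at which the profile has already reached zero, and it identifies superlevel sets of the radial
functions with balls. -/
theorem lt_profile_iff (h : IsAdmissibleProfile N ρ) {t r : ℝ} (ht : t ∈ Ioc (0 : ℝ) 1)
    (hr : 0 ≤ r) : t < profile ρ r ↔ r < hittingTime ρ t := by
  rcases (profile_mem ρ r).1.eq_or_lt with h0 | h0
  · refine iff_of_false (not_lt.2 (h0 ▸ ht.1.le)) fun hlt => ?_
    obtain ⟨s, hs, hsr⟩ := h.exists_hittingTime_eq ht hr hlt.le
    have := h.profile_hittingTime hs
    rw [hsr, ← h0] at this
    exact hs.1.ne this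
  · have h1 := hittingTime_profile h0
    conv_rhs => rw [← h1]
    exact (h.strictAntiOn_hittingTime.lt_iff_gt ⟨h0, (profile_mem ρ r).2⟩ ht).symm

theorem antitoneOn_profile (h : IsAdmissibleProfile N ρ) : AntitoneOn (profile ρ) (Ici 0) := by
  intro r hr r' hr' hrr
  by_contra! hlt
  obtain ⟨t, ht1, ht2⟩ := exists_between hlt
  have ht : t ∈ Ioc (0 : ℝ) 1 :=
    ⟨(profile_mem ρ r).1.trans_lt ht1, ht2.le.trans (profile_mem ρ r').2⟩
  have h1 := (h.lt_profile_iff ht hr').1 ht2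
  exact ht1.not_gt ((h.lt_profile_iff ht hr).2 (hrr.trans_lt h1))

theorem exists_bound (h : IsAdmissibleProfile N ρ) {δ : ℝ} (hδ : δ ∈ Ioc (0 : ℝ) 1) :
    ∃ C, 0 < C ∧ ∀ t ∈ Icc δ 1, ρ t ≤ C := by
  have hsub : Icc δ 1 ⊆ Ioc 0 1 := fun t ht => ⟨hδ.1.trans_le ht.1, ht.2⟩
  obtain ⟨C, hC⟩ := isCompact_Icc.exists_bound_of_continuousOn (h.continuousOn.mono hsub)
  have hC' : ∀ t ∈ Icc δ 1, ρ t ≤ C := fun t ht => (Real.le_norm_self _).trans (hC t ht)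
  exact ⟨C, (h.pos 1 one_mem).trans_le (hC' 1 ⟨hδ.2, le_rfl⟩), hC'⟩

/-- On `[δ, 1]` the speed `ρ` is bounded by compactness. The truncation is needed because `ρ` may be
unbounded near zero. -/
theorem exists_lipschitz (h : IsAdmissibleProfile N ρ) {δ : ℝ} (hδ : δ ∈ Ioc (0 : ℝ) 1) :
    ∃ C : NNReal, LipschitzOnWith C (fun r => max (profile ρ r) δ) (Ici 0) := by
  obtain ⟨C, hC0, hC⟩ := h.exists_bound hδ
  refine ⟨C.toNNReal, LipschitzOnWith.of_dist_le_mul fun r hr r' hr' => ?_⟩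
  rw [Real.coe_toNNReal _ hC0.le]
  wlog hrr : r ≤ r' generalizing r r'
  · rw [dist_comm, dist_comm r]; exact this r' hr' r hr (le_of_not_ge hrr)
  have hle := max_le_max_right δ (h.antitoneOn_profile hr hr' hrr)
  rw [Real.dist_eq, abs_of_nonneg (sub_nonneg.2 hle), Real.dist_eq, abs_sub_comm,
    abs_of_nonneg (sub_nonneg.2 hrr)]
  rcases hle.eq_or_lt with heq | hlt
  · rw [heq, sub_self]; exact mul_nonneg hC0.le (sub_nonneg.2 hrr)
  have h1 : max (profile ρ r) δ = profile ρ r := by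
    refine max_eq_left (le_of_lt ?_)
    by_contra! hcon
    rw [max_eq_right hcon] at hlt
    exact hlt.not_ge (le_max_right _ _)
  rw [h1] at hlt ⊢
  set t := max (profile ρ r') δ with ht
  have ht0 : t ∈ Ioc (0 : ℝ) 1 := ⟨hδ.1.trans_le (le_max_right _ _), hlt.le.trans (profile_mem ρ r).2⟩
  have hv0 : profile ρ r ∈ Ioc (0 : ℝ) 1 := ⟨ht0.1.trans hlt, (profile_mem ρ r).2⟩
  have h2 : hittingTime ρ t ≤ r' := by
    by_contra! hcon
    exact ((h.lt_profile_iff ht0 hr').2 hcon).not_ge (le_max_left _ _)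
  have h3 := h.div_le_hittingTime_sub (C := C) ht0 hv0 hlt.le
    fun τ hτ => hC τ ⟨(le_max_right _ _).trans hτ.1, hτ.2⟩
  rw [hittingTime_profile hv0.1, div_le_iff₀ hC0] at h3
  nlinarith

/-- A uniform limit of the Lipschitz truncations `max (profile ρ) δ` as `δ → 0`. -/
theorem continuousOn_profile (h : IsAdmissibleProfile N ρ) :
    ContinuousOn (profile ρ) (Ici 0) := by
  have hlim : TendstoUniformlyOn (fun (n : ℕ) r => max (profile ρ r) (1 / ((n : ℝ) + 1)))
      (profile ρ) atTop (Ici 0) := by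
    rw [Metric.tendstoUniformlyOn_iff]
    intro ε hε
    filter_upwards [(tendsto_one_div_add_atTop_nhds_zero_nat (𝕜 := ℝ)).eventually_lt_const hε]
      with n hn r _
    have h0 : (0 : ℝ) < 1 / ((n : ℝ) + 1) := by positivity
    have h1 : max (profile ρ r) (1 / ((n : ℝ) + 1)) ≤ profile ρ r + 1 / ((n : ℝ) + 1) :=
      max_le (by linarith) (by linarith [(profile_mem ρ r).1])
    have h2 := le_max_left (profile ρ r) (1 / ((n : ℝ) + 1))
    rw [Real.dist_eq, abs_sub_comm, abs_of_nonneg (by linarith)]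
    linarith
  refine hlim.continuousOn (Frequently.of_forall fun n => ?_)
  obtain ⟨C, hC⟩ := h.exists_lipschitz (δ := 1 / ((n : ℝ) + 1))
    ⟨by positivity, (div_le_one (by positivity)).2 (by linarith [n.cast_nonneg (α := ℝ)])⟩
  exact hC.continuousOn

theorem hasDerivAt_profile (h : IsAdmissibleProfile N ρ) {r : ℝ} (hr : 0 < r)
    (hv : 0 < profile ρ r) : HasDerivAt (profile ρ) (-ρ (profile ρ r)) r := by
  have hK := hittingTime_profile hv
  -- Below the value `1` the hitting time has a two-sided derivative; continuity of `ρ` is known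
  -- only on `(0, 1]`.
  have h1 : profile ρ r < 1 := by
    refine (profile_mem ρ r).2.lt_of_ne fun h1 => ?_
    rw [h1, hittingTime_one] at hK
    exact hr.ne hK
  have hca : ContinuousAt (profile ρ) r := h.continuousOn_profile.continuousAt (Ici_mem_nhds hr)
  have hρ := h.pos _ ⟨hv, h1.le⟩
  have := HasDerivAt.of_local_left_inverse hca (h.hasDerivAt_hittingTime ⟨hv, h1⟩)
    (neg_ne_zero.2 (inv_ne_zero hρ.ne')) ?_
  · rwa [← neg_inv, inv_inv] at this
  · filter_upwards [hca.eventually_const_lt hv] with s hs using hittingTime_profile hs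

theorem tendsto_profile (h : IsAdmissibleProfile N ρ) : Tendsto (profile ρ) atTop (𝓝 0) := by
  rw [Metric.tendsto_atTop]
  intro ε hε
  have hδ : min (ε / 2) 1 ∈ Ioc (0 : ℝ) 1 := ⟨lt_min (half_pos hε) one_pos, min_le_right _ _⟩
  refine ⟨max (hittingTime ρ (min (ε / 2) 1)) 0, fun r hr => ?_⟩
  have h1 : ¬ min (ε / 2) 1 < profile ρ r := fun hlt =>
    ((h.lt_profile_iff hδ ((le_max_right _ _).trans hr)).1 hlt).not_ge ((le_max_left _ _).trans hr)
  rw [Real.dist_eq, sub_zero, abs_of_nonneg (profile_mem ρ r).1]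
  exact (not_lt.1 h1).trans_lt ((min_le_left _ _).trans_lt (half_lt_self hε))

end IsAdmissibleProfile

end Profile

end MinimalCost

namespace MinimalCost

/-! ### Radial competitors: weak gradient, integrability and mass. -/

section Radial

variable {N : ℕ} {ρ : ℝ → ℝ}

theorem locallyIntegrable_of_ball {F : Type*} [NormedAddCommGroup F] {k : RN N → F}
    (hk : ∀ R, IntegrableOn k (Metric.ball 0 R)) : LocallyIntegrable k := fun y =>
  ⟨_, Metric.isOpen_ball.mem_nhds (mem_ball_zero_iff.2 (lt_add_one ‖y‖)), hk _⟩

/-- A Lipschitz function is weakly differentiable. -/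
theorem hasWeakGradient_of_lipschitz {C : NNReal} {w : RN N → ℝ} (hw : LipschitzWith C w) :
    HasWeakGradient w (gradient w) := by
  have hmeas : Measurable (gradient w) :=
    (InnerProductSpace.toDual ℝ (RN N)).symm.continuous.measurable.comp (measurable_fderiv ℝ w)
  refine ⟨hw.continuous.locallyIntegrable, ?_, fun φ hφ hc v => ?_⟩
  · refine (locallyIntegrable_const (C : ℝ)).mono hmeas.aestronglyMeasurable
      (ae_of_all _ fun y => ?_)
    rw [gradient, LinearIsometryEquiv.norm_map, Real.norm_of_nonneg C.coe_nonneg]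
    exact norm_fderiv_le_of_lipschitz ℝ hw
  · obtain ⟨D, hD⟩ := hφ.lipschitzWith_of_hasCompactSupport hc (by simp)
    have h1 := hw.integral_lineDeriv_mul_eq (μ := volume) hD hc v
    have h2 : ∫ y, lineDeriv ℝ w y v * φ y = ∫ y, φ y * inner ℝ (gradient w y) v := by
      refine integral_congr_ae ?_
      filter_upwards [hw.ae_differentiableAt] with y hy
      rw [hy.lineDeriv_eq_fderiv, inner_gradient_left, mul_comm]
    have h3 : ∫ y, lineDeriv ℝ φ y (-v) * w y = -∫ y, w y * fderiv ℝ φ y v := by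
      rw [← integral_neg]
      refine integral_congr_ae (ae_of_all _ fun y => ?_)
      simp only
      rw [(hφ.differentiable (by simp) y).lineDeriv_eq_fderiv, map_neg]
      ring
    rw [← h2, h1, h3, neg_neg]

/-- The radial function with profile `profile ρ`, started at time `a`. -/
noncomputable def radial (ρ : ℝ → ℝ) (a : ℝ) (y : RN N) : ℝ := profile ρ (‖y‖ + a)

open Classical in
/-- The gradient of `radial ρ a`. -/
noncomputable def radialGrad (ρ : ℝ → ℝ) (a : ℝ) (y : RN N) : RN N :=
  if 0 < radial ρ a y then ρ (radial ρ a y) • (-‖y‖⁻¹ • y) else 0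

theorem radial_nonneg (ρ : ℝ → ℝ) (a : ℝ) (y : RN N) : 0 ≤ radial ρ a y := (IsAdmissibleProfile.profile_mem ρ _).1

theorem continuous_radial (h : IsAdmissibleProfile N ρ) {a : ℝ} (ha : 0 ≤ a) :
    Continuous (radial ρ a : RN N → ℝ) :=
  h.continuousOn_profile.comp_continuous (by fun_prop) fun y => add_nonneg (norm_nonneg y) ha

/-- The two excluded sets, the origin and the sphere where truncation begins, are null. Elsewhere
the truncation is locally either the radial function or the constant `δ`. -/
theorem gradient_max_radial (h : IsAdmissibleProfile N ρ) {a : ℝ} (ha : 0 ≤ a) {δ : ℝ}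
    (hδ : δ ∈ Ioc (0 : ℝ) 1) {y : RN N} (hy0 : y ≠ 0) (hy : ‖y‖ + a ≠ hittingTime ρ δ) :
    gradient (fun y => max (radial ρ a y) δ) y =
      {y | δ < radial ρ a y}.indicator (radialGrad ρ a) y := by
  have hr : 0 ≤ ‖y‖ + a := by positivity
  rcases lt_or_gt_of_ne hy with hlt | hgt
  · have h1 : δ < radial ρ a y := (h.lt_profile_iff hδ hr).2 hlt
    have h0 : 0 < radial ρ a y := hδ.1.trans h1
    rw [indicator_of_mem (show y ∈ {y | δ < radial ρ a y} from h1), radialGrad, if_pos h0]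
    have hev : (fun y => max (radial ρ a y) δ) =ᶠ[𝓝 y] radial ρ a := by
      filter_upwards [(continuous_radial h ha).continuousAt.eventually_const_lt h1] with z hz
      exact max_eq_left hz.le
    rw [hev.gradient_eq]
    refine HasGradientAt.gradient ?_
    have hn : 0 < ‖y‖ := norm_pos_iff.2 hy0
    have h2 : HasFDerivAt (fun y : RN N => ‖y‖ + a) _ y :=
      ((hasStrictFDerivAt_norm_sq y).hasFDerivAt.sqrt (by positivity)).congr_of_eventuallyEq
        (Eventually.of_forall fun z => (Real.sqrt_sq (norm_nonneg z)).symm) |>.add_const a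
    have h3 := (h.hasDerivAt_profile (r := ‖y‖ + a) (by positivity) h0).comp_hasFDerivAt y h2
    rw [hasGradientAt_iff_hasFDerivAt]
    refine h3.congr_fderiv ?_
    ext v
    simp only [radial, Real.sqrt_sq hn.le, InnerProductSpace.toDual_apply_apply,
      smul_apply, real_inner_smul_left, smul_eq_mul, innerSL_apply_apply,
      nsmul_eq_mul]
    field_simp
    simp
  · have h1 : ¬ δ < radial ρ a y := fun hlt => ((h.lt_profile_iff hδ hr).1 hlt).not_gt hgt
    rw [indicator_of_notMem (show y ∉ {y | δ < radial ρ a y} from h1)]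
    have hev : (fun y => max (radial ρ a y) δ) =ᶠ[𝓝 y] fun _ => δ := by
      have hc : Continuous fun z : RN N => ‖z‖ + a := by fun_prop
      filter_upwards [hc.continuousAt.eventually_const_lt hgt] with z hz
      refine max_eq_right (not_lt.1 fun hlt => ?_)
      exact ((h.lt_profile_iff hδ (by positivity)).1 hlt).not_gt hz
    rw [hev.gradient_eq, gradient_fun_const]

/-- The majorant is the derivative of a monotone function of one variable, which is locally
integrable without any bound on `ρ` near zero. -/
theorem norm_radialGrad_le (h : IsAdmissibleProfile N ρ) {a : ℝ} (ha : 0 ≤ a) {y : RN N}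
    (hy : y ≠ 0) : ‖radialGrad ρ a y‖ ≤ |deriv (fun r => profile ρ (r + a)) ‖y‖| := by
  have hn : 0 < ‖y‖ := norm_pos_iff.2 hy
  unfold radialGrad
  split_ifs with h0
  · have h1 : HasDerivAt (fun r => profile ρ (r + a)) (-ρ (radial ρ a y)) ‖y‖ :=
      (h.hasDerivAt_profile (r := ‖y‖ + a) (by positivity) h0).comp_add_const ‖y‖ a
    rw [h1.deriv, norm_smul, norm_smul, norm_neg, norm_inv, norm_norm, inv_mul_cancel₀ hn.ne',
      mul_one, abs_neg, Real.norm_eq_abs]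
  · rw [norm_zero]; exact abs_nonneg _

/-- Dominated limit of the Lipschitz truncations at heights `δ n → 0`; where the function vanishes
all the truncated gradients are zero. -/
theorem hasWeakGradient_radial (hN : 2 ≤ N) (h : IsAdmissibleProfile N ρ) {a : ℝ} (ha : 0 ≤ a) :
    HasWeakGradient (radial ρ a : RN N → ℝ) (radialGrad ρ a) := by
  have : Nonempty (Fin N) := ⟨⟨0, by omega⟩⟩
  let δ : ℕ → ℝ := fun n => 1 / ((n : ℝ) + 1)
  have hδ : ∀ n, δ n ∈ Ioc (0 : ℝ) 1 := fun n =>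
    ⟨by positivity, (div_le_one (by positivity)).2 (by linarith [n.cast_nonneg (α := ℝ)])⟩
  have hδt : Tendsto δ atTop (𝓝 0) := tendsto_one_div_add_atTop_nhds_zero_nat
  have hgood : ∀ᵐ y : RN N, y ≠ 0 ∧ ∀ n, ‖y‖ + a ≠ hittingTime ρ (δ n) := by
    refine (Measure.ae_ne volume 0).and (ae_all_iff.2 fun n => ?_)
    have := Measure.addHaar_sphere (volume : Measure (RN N)) 0 (hittingTime ρ (δ n) - a)
    filter_upwards [measure_eq_zero_iff_ae_notMem.1 this] with y hy heq
    exact hy (mem_sphere_zero_iff_norm.2 (by linarith))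
  have hw : ∀ n, HasWeakGradient (fun y : RN N => max (radial ρ a y) (δ n))
      ({y | δ n < radial ρ a y}.indicator (radialGrad ρ a)) := fun n => by
    obtain ⟨C, hC⟩ := h.exists_lipschitz (hδ n)
    have hlip : LipschitzWith C (fun y : RN N => max (radial ρ a y) (δ n)) := by
      have h1 : LipschitzOnWith 1 (fun y : RN N => ‖y‖ + a) univ :=
        (LipschitzWith.of_dist_le_mul fun y z => by
          simpa [Real.dist_eq, dist_eq_norm] using abs_norm_sub_norm_le y z).lipschitzOnWith
      have := hC.comp h1 fun y _ => show 0 ≤ ‖y‖ + a by positivity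
      rw [mul_one, lipschitzOnWith_univ] at this
      exact this
    refine (hasWeakGradient_of_lipschitz hlip).congr_ae (ae_eq_refl _) ?_
    filter_upwards [hgood] with y hy
    exact gradient_max_radial h ha (hδ n) hy.1 (hy.2 n)
  refine HasWeakGradient.of_tendsto hw (b := fun _ => 1)
    (B := fun y => |deriv (fun r => profile ρ (r + a)) ‖y‖|) (locallyIntegrable_const _) ?_
    (fun n => ae_of_all _ fun y => ?_) (fun n => ?_) (ae_of_all _ fun y => ?_)
    (ae_of_all _ fun y => ?_)
  · refine locallyIntegrable_of_ball fun R => ?_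
    refine (integrableOn_fun_norm_addHaar volume
      (f := fun r => |deriv (fun r => profile ρ (r + a)) r|)).2 ?_
    rcases le_or_gt R 0 with hR | hR
    · simp [Ioo_eq_empty (not_lt.2 hR)]
    -- Monotonicity makes the derivative integrable on `[0, R]`; the Jacobian `r^(N-1)` of polar
    -- coordinates is bounded there.
    have hanti : AntitoneOn (fun r => profile ρ (r + a)) (uIcc 0 R) := by
      rw [uIcc_of_le hR.le]
      intro r hr s hs hrs
      exact h.antitoneOn_profile (add_nonneg hr.1 ha) (add_nonneg hs.1 ha) (by linarith)
    have hint : IntervalIntegrable (fun r => |deriv (fun r => profile ρ (r + a)) r|) volume 0 R := by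
      have := hanti.neg.intervalIntegrable_deriv.abs
      refine this.congr_ae (ae_of_all _ fun r => ?_)
      beta_reduce
      rw [deriv.fun_neg, abs_neg]
    rw [intervalIntegrable_iff_integrableOn_Ioo_of_le hR.le] at hint
    refine hint.bdd_smul (R ^ (Module.finrank ℝ (RN N) - 1))
      (continuous_pow _).aestronglyMeasurable ?_
    filter_upwards [ae_restrict_mem measurableSet_Ioo] with r hr
    rw [norm_pow, Real.norm_of_nonneg hr.1.le]
    exact pow_le_pow_left₀ hr.1.le hr.2.le _
  · rw [Real.norm_of_nonneg ((radial_nonneg ρ a y).trans (le_max_left _ _))]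
    exact max_le (IsAdmissibleProfile.profile_mem ρ _).2 (hδ n).2
  · filter_upwards [hgood] with y hy
    exact (norm_indicator_le_norm_self _ _).trans (norm_radialGrad_le h ha hy.1)
  · have := (tendsto_const_nhds (x := radial ρ a y)).max hδt
    rwa [max_eq_left (radial_nonneg ρ a y)] at this
  · rcases (radial_nonneg ρ a y).eq_or_lt with h0 | h0
    · refine tendsto_const_nhds.congr fun n => ?_
      rw [indicator_of_notMem (show y ∉ {y | δ n < radial ρ a y} from ?_), radialGrad,
        if_neg (by rw [← h0]; exact lt_irrefl _)]
      exact not_lt.2 (h0 ▸ (hδ n).1.le)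
    · refine tendsto_const_nhds.congr' ?_
      filter_upwards [hδt.eventually_lt_const h0] with n hn
      exact (indicator_of_mem (show y ∈ {y | δ n < radial ρ a y} from hn) _).symm

/-- Layer-cake formula: the set `{radial > t}` is a ball of radius `hittingTime ρ t`, so the mass is
the integral in the admissibility condition times the volume of the unit ball. -/
theorem integrable_radial (h : IsAdmissibleProfile N ρ) (hN : 1 ≤ N) :
    Integrable (radial ρ 0 : RN N → ℝ) := by
  have : Nonempty (Fin N) := ⟨⟨0, by omega⟩⟩
  have hc := continuous_radial h le_rfl
  refine ⟨hc.aestronglyMeasurable, ?_⟩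
  rw [hasFiniteIntegral_iff_ofReal (ae_of_all _ (radial_nonneg ρ 0)),
    lintegral_eq_lintegral_meas_lt _ (ae_of_all _ (radial_nonneg ρ 0)) hc.aemeasurable]
  have hball : ∀ t ∈ Ioi (0 : ℝ), volume {y : RN N | t < radial ρ 0 y} ≤
      (Ioc (0 : ℝ) 1).indicator (fun t => (∫⁻ τ in Ioc t 1, ENNReal.ofReal (1 / ρ τ)) ^ N *
        volume (Metric.ball (0 : RN N) 1)) t := fun t ht => by
    by_cases ht1 : t ≤ 1
    · have ht' : t ∈ Ioc (0 : ℝ) 1 := ⟨ht, ht1⟩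
      rw [indicator_of_mem ht']
      have hset : {y : RN N | t < radial ρ 0 y} = Metric.ball 0 (hittingTime ρ t) := by
        ext y
        rw [mem_ball_zero_iff]
        have := h.lt_profile_iff ht' (norm_nonneg y)
        simpa [radial] using this
      have hK : ENNReal.ofReal (hittingTime ρ t) = ∫⁻ τ in Ioc t 1, ENNReal.ofReal (1 / ρ τ) := by
        rw [hittingTime, intervalIntegral.integral_of_le ht1,
          ofReal_integral_eq_lintegral_ofReal
          (h.intervalIntegrable_inv ht' IsAdmissibleProfile.one_mem).1]
        · simp
        · filter_upwards [ae_restrict_mem measurableSet_Ioc] with τ hτ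
          exact (inv_pos.2 (h.pos τ ⟨ht'.1.trans hτ.1, hτ.2⟩)).le
      rw [hset, Measure.addHaar_ball _ _ (h.hittingTime_nonneg ht'), finrank_euclideanSpace_fin,
        ENNReal.ofReal_pow (h.hittingTime_nonneg ht'), hK]
    · have : {y : RN N | t < radial ρ 0 y} = ∅ := by
        ext y
        simp only [mem_ofPred_eq, mem_empty_iff_false, iff_false, not_lt]
        exact (IsAdmissibleProfile.profile_mem ρ _).2.trans (not_le.1 ht1).le
      rw [this, measure_empty]; exact zero_le
  refine (setLIntegral_mono' measurableSet_Ioi hball).trans_lt ?_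
  refine (setLIntegral_le_lintegral _ _).trans_lt ?_
  rw [lintegral_indicator measurableSet_Ioc, lintegral_mul_const' _ _ measure_ball_lt_top.ne]
  exact ENNReal.mul_lt_top h.lintegral_lt_top measure_ball_lt_top

theorem radial_le (h : IsAdmissibleProfile N ρ) {a b : ℝ} (ha : 0 ≤ a) (hab : a ≤ b) (y : RN N) :
    radial ρ b y ≤ radial ρ a y :=
  h.antitoneOn_profile (show 0 ≤ ‖y‖ + a by positivity)
    (show 0 ≤ ‖y‖ + b from add_nonneg (norm_nonneg y) (ha.trans hab)) (by linarith)

/-- Radial competitors of every small mass. -/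
theorem exists_radial_mass (h : IsAdmissibleProfile N ρ) (hN : 1 ≤ N) {η : ℝ} (hη : 0 < η) :
    ∀ᶠ m in 𝓝[>] (0 : ℝ), ∃ a, 0 ≤ a ∧ (∀ y : RN N, radial ρ a y < η) ∧
      ∫⁻ y : RN N, ENNReal.ofReal (radial ρ a y) = ENNReal.ofReal m := by
  have h0 := integrable_radial h hN
  let M : ℝ → ℝ := fun a => ∫ y : RN N, radial ρ (max a 0) y
  have hdom : ∀ a, ∀ᵐ y : RN N, ‖radial ρ (max a 0) y‖ ≤ radial ρ 0 y := fun a =>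
    ae_of_all _ fun y => by
      rw [Real.norm_of_nonneg (radial_nonneg ρ _ y)]
      exact radial_le h le_rfl (le_max_right _ _) y
  have hmeas : ∀ a, AEStronglyMeasurable (fun y : RN N => radial ρ (max a 0) y) volume := fun a =>
    (continuous_radial h (le_max_right a 0)).aestronglyMeasurable
  have hMc : Continuous M := by
    refine continuous_of_dominated hmeas hdom h0 (ae_of_all _ fun y => ?_)
    exact h.continuousOn_profile.comp_continuous (by fun_prop)
      fun a => add_nonneg (norm_nonneg y) (le_max_right a 0)
  have hM0 : Tendsto M atTop (𝓝 0) := by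
    rw [← integral_zero (RN N) ℝ (μ := volume)]
    refine tendsto_integral_filter_of_dominated_convergence _ (Eventually.of_forall hmeas)
      (Eventually.of_forall hdom) h0 (ae_of_all _ fun y => ?_)
    refine h.tendsto_profile.comp (tendsto_atTop_add_const_left _ ‖y‖ ?_)
    exact tendsto_atTop_mono (fun a => le_max_left a 0) tendsto_id
  -- Starting at a time `a ≥ hittingTime ρ t` keeps the values at most `t < η`. By continuity of the
  -- mass in `a` and its decay to zero, such starting times attain every positive mass below `M a₁`.
  set t := min (η / 2) 1 with ht
  have ht' : t ∈ Ioc (0 : ℝ) 1 := ⟨lt_min (half_pos hη) one_pos, min_le_right _ _⟩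
  set a₁ := hittingTime ρ t with ha₁
  have ha₁0 : 0 ≤ a₁ := h.hittingTime_nonneg ht'
  have hM1 : 0 < M a₁ := by
    have hi : Integrable (fun y : RN N => radial ρ (max a₁ 0) y) := h0.mono' (hmeas _) (hdom _)
    refine (integral_pos_iff_support_of_nonneg (radial_nonneg ρ _) hi).2 ?_
    refine IsOpen.measure_pos volume
      ((continuous_radial h (le_max_right a₁ 0)).isOpen_support) ⟨0, ?_⟩
    rw [Function.mem_support, radial, norm_zero, zero_add, max_eq_left ha₁0,
      h.profile_hittingTime ht']
    exact ht'.1.ne'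
  filter_upwards [Ioo_mem_nhdsGT hM1] with m hm
  obtain ⟨a₂, ha₂, ha₁₂⟩ := ((hM0.eventually_lt_const hm.1).and (eventually_ge_atTop a₁)).exists
  obtain ⟨a, ha, hMa⟩ := intermediate_value_Icc' ha₁₂ hMc.continuousOn ⟨ha₂.le, hm.2.le⟩
  have ha0 : 0 ≤ a := ha₁0.trans ha.1
  refine ⟨a, ha0, fun y => ?_, ?_⟩
  · have h1 : ¬ t < radial ρ a y := fun hlt => by
      have := (h.lt_profile_iff ht' (by positivity)).1 hlt
      have := norm_nonneg y
      linarith [ha.1]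
    exact (not_lt.1 h1).trans_lt ((min_le_left _ _).trans_lt (half_lt_self hη))
  · have h1 : ∫ y : RN N, radial ρ a y = m := by
      rw [← hMa]; simp only [M, max_eq_left ha0]
    have hi : Integrable (fun y : RN N => radial ρ a y) := by
      have := h0.mono' (hmeas a) (hdom a)
      rwa [max_eq_left ha0] at this
    rw [← h1, ofReal_integral_eq_lintegral_ofReal hi (ae_of_all _ (radial_nonneg ρ a))]

end Radial

/-! ### Upper bound in dimension at least two. -/

section Upper

variable {N : ℕ} {f : RN N → ℝ → RN N → ℝ≥0∞} {ρ : ℝ → ℝ}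

/-- The upper bound for the minimal cost in dimension at least two. -/
theorem limsup_le_of_two_le_dim (hN : 2 ≤ N) (hf : HypLsc f) {x : RN N}
    (hρ : IsAdmissibleProfile N ρ) (hslope : upperSlope (Ioi 0) f ρ x ≤ lowerSlope (Ioi 0) f x) :
    limsup (fun m : ℝ => minimalCost f x m / ENNReal.ofReal |m|) (𝓝[>] 0) ≤
      lowerSlope (Ioi 0) f x := by
  refine le_of_forall_gt fun c hc => ?_
  obtain ⟨c', hc', hcc⟩ := exists_between hc
  refine lt_of_le_of_lt ?_ hcc
  have hf0 := hf.apply_zero_eq_zero hc.ne_top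
  obtain ⟨η, hη, hη'⟩ := mem_nhdsGT_iff_exists_Ioo_subset.1
    (eventually_lt_of_limsup_lt (hslope.trans_lt hc'))
  refine limsup_le_of_le (by isBoundedDefault) ?_
  filter_upwards [exists_radial_mass hρ (by omega : 1 ≤ N) hη, self_mem_nhdsWithin] with m hm hmp
  replace hmp : 0 < m := hmp
  obtain ⟨a, ha, hlt, hmass⟩ := hm
  rw [abs_of_pos hmp]
  refine ENNReal.div_le_of_le_mul ?_
  refine (minimalCost_le_of_nonneg hmp.le (hasWeakGradient_radial hN hρ ha) (radial_nonneg ρ a)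
    hmass).trans ?_
  rw [← hmass, ← lintegral_const_mul' _ _ hcc.ne_top]
  have : Nonempty (Fin N) := ⟨⟨0, by omega⟩⟩
  refine lintegral_mono_ae ?_
  filter_upwards [Measure.ae_ne volume (0 : RN N)] with y hy
  -- Where the competitor is positive its gradient is `ρ(u)` times a unit vector, so the integrand
  -- is at most `c' u`; elsewhere it is `f(x, 0, 0) = 0`.
  rcases (radial_nonneg ρ a y).eq_or_lt with h0 | h0
  · rw [radialGrad, if_neg (by rw [← h0]; exact lt_irrefl _), ← h0, hf0]
    exact zero_le
  · have h1 := hη' ⟨h0, hlt y⟩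
    have hξ : ‖-‖y‖⁻¹ • y‖ = 1 := by
      rw [norm_smul, norm_neg, norm_inv, norm_norm, inv_mul_cancel₀ (norm_ne_zero_iff.2 hy)]
    rw [radialGrad, if_pos h0]
    have h2 := (le_iSup₂ (f := fun (ξ : RN N) (_ : ‖ξ‖ = 1) =>
      f x (radial ρ a y) (ρ |radial ρ a y| • ξ) / ENNReal.ofReal |radial ρ a y|) _ hξ).trans
      (le_of_lt h1)
    simp only [abs_of_pos h0] at h2
    exact (ENNReal.div_le_iff (by simpa using h0) ENNReal.ofReal_ne_top).1 h2

end Upper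

end MinimalCost

namespace MinimalCost

/-! ### Reflection exchanging the two sides of the origin. -/

section Reflection

variable {N : ℕ} {f : RN N → ℝ → RN N → ℝ≥0∞}

/-- The reflected Lagrangian `f(x, -u, -ξ)`. -/
def reflect (f : RN N → ℝ → RN N → ℝ≥0∞) : RN N → ℝ → RN N → ℝ≥0∞ :=
  fun x u ξ => f x (-u) (-ξ)

theorem reflect_reflect (f : RN N → ℝ → RN N → ℝ≥0∞) : reflect (reflect f) = f := by
  funext x u ξ; simp only [reflect, neg_neg]

theorem HypLsc.reflect (hf : HypLsc f) : HypLsc (reflect f) :=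
  LowerSemicontinuous.comp (f := fun z : RN N × ℝ × RN N => f z.1 z.2.1 z.2.2) hf
    (g := fun z : RN N × ℝ × RN N => (z.1, -z.2.1, -z.2.2)) (by fun_prop)

theorem HypCompact.reflect (hf : HypCompact f) : HypCompact (reflect f) := by
  obtain ⟨α, β, p, hα, hβ, hp, h⟩ := hf
  refine ⟨α, β, p, hα, hβ, hp, fun x u ξ => ?_⟩
  simpa only [norm_neg, abs_neg, MinimalCost.reflect] using h x (-u) (-ξ)

theorem minimalCost_reflect_le (f : RN N → ℝ → RN N → ℝ≥0∞) (x : RN N) (m : ℝ) :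
    minimalCost (reflect f) x (-m) ≤ minimalCost f x m := by
  refine le_iInf₂ fun u hu => le_iInf₂ fun G hG => ?_
  refine (iInf₂_le (fun y => -u y) ⟨hu.1.neg, by rw [integral_neg, hu.2]⟩).trans ?_
  refine (iInf₂_le (fun y => -G y) hG.neg).trans ?_
  simp only [reflect, neg_neg, le_refl]

theorem minimalCost_reflect (f : RN N → ℝ → RN N → ℝ≥0∞) (x : RN N) (m : ℝ) :
    minimalCost (reflect f) x (-m) = minimalCost f x m := by
  refine (minimalCost_reflect_le f x m).antisymm ?_
  simpa only [reflect_reflect, neg_neg] using minimalCost_reflect_le (reflect f) x (-m)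

theorem map_neg_nhdsGT_zero : map (fun u : ℝ => -u) (𝓝[>] 0) = 𝓝[<] 0 := by
  simp

theorem lowerSlope_reflect (f : RN N → ℝ → RN N → ℝ≥0∞) (x : RN N) :
    lowerSlope (Ioi 0) (reflect f) x = lowerSlope (Iio 0) f x := by
  have h0 : map (fun ξ : RN N => -ξ) (𝓝 0) = 𝓝 0 := by
    simpa using (Homeomorph.neg (RN N)).map_nhds_eq 0
  have hmap : map (fun z : RN N × ℝ × RN N => (z.1, -z.2.1, -z.2.2))
      (𝓝 x ×ˢ 𝓝[>] (0 : ℝ) ×ˢ 𝓝 (0 : RN N)) = 𝓝 x ×ˢ 𝓝[<] (0 : ℝ) ×ˢ 𝓝 (0 : RN N) := by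
    conv_rhs => rw [← map_neg_nhdsGT_zero, ← h0, prod_map_map_eq, ← map_id (f := 𝓝 x),
      prod_map_map_eq]
    rfl
  rw [lowerSlope, lowerSlope, ← hmap]
  simp only [liminf, map_map, reflect, Function.comp_def, abs_neg]

theorem upperSlope_reflect (f : RN N → ℝ → RN N → ℝ≥0∞) (ρ : ℝ → ℝ) (x : RN N) :
    upperSlope (Ioi 0) (reflect f) ρ x = upperSlope (Iio 0) f ρ x := by
  rw [upperSlope, upperSlope, ← map_neg_nhdsGT_zero]
  simp only [limsup, map_map, reflect, Function.comp_def, abs_neg]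
  congr 2
  funext u
  refine (Equiv.neg (RN N)).iSup_congr fun ξ => ?_
  simp only [Equiv.neg_apply, norm_neg, smul_neg]

theorem HypSlope.reflect (hf : HypSlope (Iio 0) f) : HypSlope (Ioi 0) (reflect f) := fun x => by
  obtain ⟨ρ, h1, h2, h3⟩ := hf x
  exact ⟨ρ, h1, h2, by rwa [lowerSlope_reflect, upperSlope_reflect]⟩

end Reflection

/-- The slope at `0⁺` of the minimal cost. -/
theorem tendsto_minimalCost_div_nhdsGT {N : ℕ} {f : RN N → ℝ → RN N → ℝ≥0∞} (hlsc : HypLsc f)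
    (hcompact : HypCompact f) (hslope : HypSlope (Ioi 0) f) (x : RN N)
    (hN : 2 ≤ N ∨ (N = 1 ∧ ∃ m ∈ Ioi (0 : ℝ), minimalCost f x m ≠ ⊤)) :
    Tendsto (fun m : ℝ => minimalCost f x m / ENNReal.ofReal |m|) (𝓝[>] 0)
      (𝓝 (lowerSlope (Ioi 0) f x)) := by
  obtain ⟨ρ, hρ1, hρ2, hle⟩ := hslope x
  refine tendsto_of_le_liminf_of_limsup_le
    (lowerSlope_le_liminf (by omega) hcompact x) ?_
  rcases hN with hN | ⟨rfl, m₀, hm₀, hfin⟩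
  · exact limsup_le_of_two_le_dim hN hlsc (hρ2 hN) hle
  · rw [hρ1 rfl] at hle
    by_cases hx : lowerSlope (Ioi 0) f x = ⊤
    · rw [hx]; exact le_top
    refine limsup_le_of_le (by isBoundedDefault) ?_
    filter_upwards [self_mem_nhdsWithin] with m hm
    rw [abs_of_pos hm]
    exact ENNReal.div_le_of_le_mul (minimalCost_le_of_dim_one hlsc hle hx hm₀ hfin hm)

end MinimalCost

theorem mainTheorem10 (N : ℕ)
    (f : EuclideanSpace ℝ (Fin N) → ℝ → EuclideanSpace ℝ (Fin N) → ℝ≥0∞)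
    (s : Set ℝ) (hs : s = Ioi 0 ∨ s = Iio 0)
    (hlsc : MinimalCost.HypLsc f)
    (hcompact : MinimalCost.HypCompact f)
    (hslope : MinimalCost.HypSlope s f)
    (x : EuclideanSpace ℝ (Fin N))
    (hN : 2 ≤ N ∨ (N = 1 ∧ ∃ m ∈ s, MinimalCost.minimalCost f x m ≠ ⊤)) :
    Tendsto (fun m : ℝ => MinimalCost.minimalCost f x m / ENNReal.ofReal |m|)
      (𝓝[s] 0) (𝓝 (MinimalCost.lowerSlope s f x)) := by
  rcases hs with rfl | rfl
  · exact MinimalCost.tendsto_minimalCost_div_nhdsGT hlsc hcompact hslope x hN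
  -- The negative side is the positive side for the reflected Lagrangian, whose cost at `-m` is the
  -- original cost at `m`.
  · have hN' : 2 ≤ N ∨ (N = 1 ∧ ∃ m ∈ Ioi (0 : ℝ),
        MinimalCost.minimalCost (MinimalCost.reflect f) x m ≠ ⊤) := by
      refine hN.imp_right fun ⟨h1, m, hm, hfin⟩ => ⟨h1, -m, mem_Ioi.2 (neg_pos.2 hm), ?_⟩
      rwa [MinimalCost.minimalCost_reflect]
    have h := MinimalCost.tendsto_minimalCost_div_nhdsGT hlsc.reflect hcompact.reflect
      hslope.reflect x hN'
    rw [MinimalCost.lowerSlope_reflect] at h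
    rw [← MinimalCost.map_neg_nhdsGT_zero, tendsto_map'_iff]
    refine h.congr fun m => ?_
    rw [Function.comp_apply, abs_neg, ← MinimalCost.minimalCost_reflect f, neg_neg]
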